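/- Let $\sigma,\rho\subseteq\mathbb{N}$ be non-empty sets, each finite or cofinite. For $\tau\in\{\sigma,\rho\}$ let $\ell_\tau=\max\tau$ if $\tau$ is finite, $\ell_\tau=0$ if $\tau=\mathbb{N}$, and $\ell_\tau=\max(\mathbb{N}\setminus\tau)+1$ otherwise. The label set is $C=C_\sigma\cup C_\rho$ (a disjoint union), where $C_\tau=\{|0|_\tau,\dots,|\ell_\tau-1|_\tau,|\ell_\tau|_\tau\}$ if $\tau$ is finite and $C_\tau=\{|0|_\tau,\dots,|\ell_\tau-1|_\tau,|{\ge}\ell_\tau|_\tau\}$ if $\tau$ is cofinite; put $s=|C|=\ell_\sigma+\ell_\rho+2$. The label $|l|_\tau$ describes the number $l$, and $|{\ge}\ell_\tau|_\tau$ describes every number $\ge\ell_\tau$. *Memoisation tables.* Let $G=(V,E)$ be a graph with $n$ vertices and a rooted tree decomposition with bags $X_i$ (the root bag need not be empty). For a node $i$ let $V_i$ be the union of $X_i$ and the bags of all descendants of $i$, let $E_i\subseteq E$ be the set of edges with at least one endpoint in $V_i\setminus X_i$, and let $G_i=(V_i,E_i)$. A partial solution on $G_i$ is a set $D\subseteq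 V_i$ such that for every $v\in V_i\setminus X_i$ we have $|N_{G_i}(v)\cap D|\in\sigma$ if $v\in D$, and $|N_{G_i}(v)\cap D|\in\rho$ if $v\notin D$. A colouring $c\in C^{X_i}$ describes $D$ if for every $v\in X_i$ the label $c(v)$ lies in $C_\sigma$ if $v\in D$ and in $C_\rho$ if $v\notin D$, and describes the number $|N_{G_i}(v)\cap D|$. For the minimisation (respectively maximisation) variant of the $[\sigma,\rho]$-domination problem, $A_i(c)$ is the minimum (respectively maximum) of $|D\setminus X_i|$ over all partial solutions $D$ on $G_i$ described by $c$, and $A_i(c)=\infty$ if there are none. A join node is a node $i$ with exactly two children $l,r$ and $X_l=X_r=X_i$. *Join of tables.* For labels $a,b,c$ of the same type $\tau$ with numbers $x_a,x_b,x_c$, write $a\oplus b=c$ if $x_a+x_b=x_c$, or if $\tau$ is cofinite, $c=|{\ge}\ell_\tau|_\tau$ and $x_a+x_b\ge\ell_\tau$ (the number of $|{\ge}\ell_\tau|_\tau$ being $\ell_\tau$); in all other cases, and for labels of different types, the sum is undefined. On $C^k$ the operation $\oplus$ is coordinate-wise. For $A_l,A_r:C^k\to\mathbb{N}\cup\{\infty\}$,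 their join is the table that assigns to $c\in C^k$ the minimum (respectively maximum) of $A_l(c_l)+A_r(c_r)$ over all $c_l,c_r\in C^k$ with $c_l\oplus c_r=c$ and both values finite, and $\infty$ if there are no such pairs. *Arithmetic operations.* Computations are straight-line programs over a prime field $\mathbb{F}_p$ in which a root of unity $\omega$ has been chosen. Each of the following counts as one operation: reading a table entry, an integer constant, a power of $\omega$, one of $+,-,\cdot,/$ (with $a/0=0$) applied to computed values, and the selection "$a$ if $t=0$, else $b$" for computed values $t,a,b$. A table entry $m\in\mathbb{N}$ is represented by $m\in\mathbb{F}_p$, and $\infty$ by $-1$. **Theorem.** There is an absolute constant $K\in\mathbb{N}$ such that, for each of the two optimisation variants, all $\sigma,\rho$ as above and all integers $k,n\ge1$, there are integers $R\ge1$ and $M\ge 2n+1$ with $R,M\le(s^kn)^K$ (that is, numbers of $O(k\log s+\log n)$ bits), and a program with at most $$K\,s^{k+1}\,k\,n\,(k\log s+\log n)$$ operations, such that for every prime $p>M$ and every primitive $R$-th root of unity $\omega\in\mathbb{F}_p$ the following hold. 1. Given any two tables $A_l,A_r:C^k\to\{0,\dots,n\}\cup\{\infty\}$, the program computes their join. 2.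 For every $n$-vertex graph $G$, every rooted tree decomposition of $G$, every join node $i$ with $|X_i|=k$ and children $l,r$, and every ordering of $X_i$ (by which $C^{X_i}$ is identified with $C^k$), given the memoisation tables $A_l$ and $A_r$ the program computes the memoisation table $A_i$. -/

import Mathlib

namespace SigmaRho

/-! ### Labels and state colourings -/

/-- The number `ℓ` in the last label of the label set belonging to `τ` (`τ = σ` or `τ = ρ`):
`max τ` if `τ` is finite, and `max (ℕ \ τ) + 1` (or `0` if `τ = ℕ`) if `τ` is cofinite. -/
noncomputable def lastLabel (τ : Set ℕ) : ℕ :=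
  open scoped Classical in
  if τ.Finite then sSup τ else sSup ((fun m => m + 1) '' τᶜ)

/-- The label set `C = C_σ ∪ C_ρ`. The label `Sum.inl l` stands for `|l|_σ` and `Sum.inr l` for
`|l|_ρ`, where the last label (`l = ℓ`) stands for `|≥ℓ|` if the set is cofinite. -/
abbrev Label (σ ρ : Set ℕ) : Type :=
  Fin (lastLabel σ + 1) ⊕ Fin (lastLabel ρ + 1)

/-- The number `s = |C|` of labels. -/
noncomputable def numLabels (σ ρ : Set ℕ) : ℕ := Fintype.card (Label σ ρ)

/-- The label with number `l` describes a vertex with `m` neighbours in the solution set. -/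
def HasLabel (τ : Set ℕ) (l : Fin (lastLabel τ + 1)) (m : ℕ) : Prop :=
  m = (l : ℕ) ∨ (¬ τ.Finite ∧ (l : ℕ) = lastLabel τ ∧ lastLabel τ ≤ m)

/-- State colourings of `k` vertices. -/
abbrev Colouring (σ ρ : Set ℕ) (k : ℕ) : Type := Fin k → Label σ ρ

/-- `a ⊕ b = c` for labels: addition inside `C_σ` and inside `C_ρ`, where a sum that reaches `ℓ`
gives `|≥ℓ|` for a cofinite set, and a sum that exceeds `ℓ` is undefined for a finite one. -/
def LabelJoin {σ ρ : Set ℕ} : Label σ ρ → Label σ ρ → Label σ ρ → Prop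
  | Sum.inl a, Sum.inl b, Sum.inl c => HasLabel σ c ((a : ℕ) + (b : ℕ))
  | Sum.inr a, Sum.inr b, Sum.inr c => HasLabel ρ c ((a : ℕ) + (b : ℕ))
  | _, _, _ => False

/-! ### Memoisation tables -/

/-- The two optimisation variants. -/
inductive Objective
  | minimise
  | maximise

/-- The smallest, respectively largest, element of `S`; `none` (for `∞`) if `S` is empty. It is
used for bounded sets only. -/
noncomputable def optimum (o : Objective) (S : Set ℕ) : Option ℕ :=
  open scoped Classical in
  if S.Nonempty then
    match o with
    | Objective.minimise => some (sInf S)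
    | Objective.maximise => some (sSup S)
  else none

/-- A memoisation table `C^k → ℕ ∪ {∞}`, with `none` for `∞`. -/
abbrev Table (σ ρ : Set ℕ) (k : ℕ) : Type := Colouring σ ρ k → Option ℕ

/-- The join of two tables: the best value of `A_l(c_l) + A_r(c_r)` over all pairs of colourings
with `c_l ⊕ c_r = c`. -/
noncomputable def joinTable {σ ρ : Set ℕ} {k : ℕ} (o : Objective) (Al Ar : Table σ ρ k) :
    Table σ ρ k := fun c =>
  optimum o {m | ∃ (cl cr : Colouring σ ρ k) (a b : ℕ),
    (∀ j, LabelJoin (cl j) (cr j) (c j)) ∧ Al cl = some a ∧ Ar cr = some b ∧ m = a + b}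

/-! ### Rooted tree decompositions -/

/-- A tree decomposition of `G` with nodes `T` and an assigned root. -/
structure RootedTreeDecomposition {V : Type*} (G : SimpleGraph V) (T : Type*) where
  tree : SimpleGraph T
  isTree : tree.IsTree
  root : T
  bag : T → Set V
  exists_mem_bag : ∀ v : V, ∃ i, v ∈ bag i
  exists_edge_bag : ∀ u v : V, G.Adj u v → ∃ i, u ∈ bag i ∧ v ∈ bag i
  connected : ∀ (v : V) (i j m : T) (w : tree.Walk i j), w.IsPath → m ∈ w.support →
    v ∈ bag i → v ∈ bag j → v ∈ bag m

namespace RootedTreeDecomposition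

variable {V : Type*} {G : SimpleGraph V} {T : Type*} (t : RootedTreeDecomposition G T)

/-- `j` is `i` or a descendant of `i`: the path from the root to `j` visits `i`. -/
def Below (i j : T) : Prop :=
  ∀ w : t.tree.Walk t.root j, w.IsPath → i ∈ w.support

/-- `j` is a child of `i`. -/
def IsChild (i j : T) : Prop := t.tree.Adj i j ∧ t.Below i j

/-- `i` is a join node with child nodes `l` and `r`. -/
def IsJoinNode (i l r : T) : Prop :=
  l ≠ r ∧ (∀ j, t.IsChild i j ↔ j = l ∨ j = r) ∧ t.bag l = t.bag i ∧ t.bag r = t.bag i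

/-- The vertex set `V_i` of `G_i`: the union of the bags of `i` and of its descendants. -/
def verts (i : T) : Set V := {v | ∃ j, t.Below i j ∧ v ∈ t.bag j}

/-- The edges `E_i` of `G_i`: the edges of `G` with at least one endpoint in `V_i \ X_i`. -/
def nodeGraph (i : T) : SimpleGraph V where
  Adj u v := G.Adj u v ∧ (u ∈ t.verts i \ t.bag i ∨ v ∈ t.verts i \ t.bag i)
  symm := ⟨fun _ _ h => ⟨h.1.symm, h.2.symm⟩⟩
  loopless := ⟨fun _ h => G.irrefl h.1⟩

/-- The number of neighbours that `v` has in `D` in the graph `G_i`. -/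
noncomputable def degIn (i : T) (D : Set V) (v : V) : ℕ :=
  {u | u ∈ D ∧ (t.nodeGraph i).Adj v u}.ncard

/-- `D` is a partial solution on `G_i`: a set of vertices of `G_i` such that every vertex outside
the bag `X_i` has an admissible number of neighbours in `D`. -/
def IsPartialSolution (σ ρ : Set ℕ) (i : T) (D : Set V) : Prop :=
  D ⊆ t.verts i ∧ ∀ v ∈ t.verts i \ t.bag i,
    (v ∈ D → t.degIn i D v ∈ σ) ∧ (v ∉ D → t.degIn i D v ∈ ρ)

/-- The label `c` describes the vertex `v` with respect to the partial solution `D` on `G_i`. -/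
def VertexHasLabel {σ ρ : Set ℕ} (i : T) (D : Set V) (v : V) : Label σ ρ → Prop
  | Sum.inl l => v ∈ D ∧ HasLabel σ l (t.degIn i D v)
  | Sum.inr l => v ∉ D ∧ HasLabel ρ l (t.degIn i D v)

/-- The memoisation table `A_i`, where `x` lists the vertices of the bag `X_i`: the best size
outside `X_i` of a partial solution on `G_i` in the class described by the colouring. -/
noncomputable def memoTable (σ ρ : Set ℕ) (o : Objective) (i : T) {k : ℕ} (x : Fin k → V) :
    Table σ ρ k := fun c =>
  optimum o {m | ∃ D : Set V, t.IsPartialSolution σ ρ i D ∧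
    (∀ j, t.VertexHasLabel i D (x j) (c j)) ∧ m = (D \ t.bag i).ncard}

end RootedTreeDecomposition

/-! ### Counting arithmetic operations -/

/-- The instructions of a straight-line program with inputs indexed by `ι`, to be run over a field
`F` with a chosen root of unity `ω`. Every instruction computes one new value; values computed
earlier are referred to by their positions. The instructions are: an input, an integer constant, a
power of `ω`, the four field operations, and a test for zero, where `ifZero t a b` is the value `a`
if the value `t` is zero, and the value `b` otherwise. -/
inductive Instr (ι : Type*)
  | input (i : ι)
  | const (z : ℤ)
  | root (e : ℕ)
  | add (a b : ℕ)
  | sub (a b : ℕ)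
  | mul (a b : ℕ)
  | div (a b : ℕ)
  | ifZero (t a b : ℕ)

/-- The value computed by an instruction, given the list of the values computed so far. -/
def Instr.eval {F ι : Type*} [Field F] [DecidableEq F] (ω : F) (inp : ι → F) (mem : List F) :
    Instr ι → F
  | .input i => inp i
  | .const z => (z : F)
  | .root e => ω ^ e
  | .add a b => mem.getD a 0 + mem.getD b 0
  | .sub a b => mem.getD a 0 - mem.getD b 0
  | .mul a b => mem.getD a 0 * mem.getD b 0
  | .div a b => mem.getD a 0 / mem.getD b 0
  | .ifZero t a b => if mem.getD t 0 = 0 then mem.getD a 0 else mem.getD b 0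

/-- A program: its instructions, and the positions at which the outputs, indexed by `κ`, are
found. -/
structure Program (ι κ : Type*) where
  code : List (Instr ι)
  out : κ → ℕ

/-- The number of operations of a program; every instruction counts. -/
def Program.cost {ι κ : Type*} (P : Program ι κ) : ℕ := P.code.length

/-- The outputs of a program. -/
def Program.eval {F ι κ : Type*} [Field F] [DecidableEq F] (P : Program ι κ) (ω : F)
    (inp : ι → F) : κ → F := fun o =>
  (P.code.foldl (fun mem ins => mem ++ [ins.eval ω inp mem]) []).getD (P.out o) 0

/-- The element of `𝔽_p` that represents a table entry; `∞` is represented by `-1`. -/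
def encode (p : ℕ) : Option ℕ → ZMod p
  | none => -1
  | some m => (m : ZMod p)

/-- The inputs of a join: `A_l` (index `Sum.inl c`) and `A_r` (index `Sum.inr c`). -/
def encodeTables {σ ρ : Set ℕ} {k : ℕ} (p : ℕ) (Al Ar : Table σ ρ k) :
    Colouring σ ρ k ⊕ Colouring σ ρ k → ZMod p
  | Sum.inl c => encode p (Al c)
  | Sum.inr c => encode p (Ar c)

end SigmaRho

/-! Encode a table entry `m` by the monomial X^m and ∞ by 0. In the ⊕-product of two encoded tables,
the coefficient of X^m at `c` is the number of pairs of colourings with join `c` and total value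
`m`, so the join is the least or greatest exponent with nonzero coefficient. The counts are at most
s^(2k) < p, so they vanish in 𝔽_p only if no pair exists. The product is computed at N = 2^q > 2n
powers of a root θ of order N, and a fast Fourier transform recovers its coefficients
(`sum_joinTensor`, `Derives.fft`).

At a single point this is a bilinear product on the k-fold tensor power of the algebra spanned by
the labels. With L the number of exact labels, the block of τ is K[x]/x^L for finite τ, and K[x]/x^L
× K for cofinite τ, where |l| is (x^l, 1) and |≥ℓ| is (0, 1). Nilpotents prevent diagonalisation, so
x^L = 0 is deformed into x^L = ε^e, where ε is a primitive root of order k+1. Evaluation at L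
distinct points diagonalises the deformed block (`sum_interpEntry`), whose structure constants are T
+ ε^e W with W the part that wraps around. A product of these over k coordinates has degree at most
k in ε^e, so the sum over e = 0, ..., k isolates the product of the T
(`IsPrimitiveRoot.sum_prod_add_mul`). There are (k+1)N pairs of a deformation and a point; each
costs O(k s^(k+1)) if coordinates are transformed one at a time (`Derives.tensor`). No division is
needed: the result is scaled by divisors of R, which are nonzero because a primitive R-th root
exists.

One program must serve all primes and all tables, so a computed value is a family over all
environments, and `Derives` counts instructions uniformly in them.

For memoisation tables, V_l ∩ V_r = X_i, and E_i is the disjoint union of E_l and E_r. Hence D ↦ (D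
∩ V_l, D ∩ V_r) identifies partial solutions on G_i with pairs that agree on X_i; degrees and sizes
outside the bag add up, so A_i is the join of A_l and A_r (`IsJoinNode.memoTable_eq`). -/

namespace SigmaRho

/-! ### Deriving values by straight-line code -/

section Derivations

variable {ι E : Type*} {F : E → Type*} [∀ x, Field (F x)] [∀ x, DecidableEq (F x)]

/-- The list of all values computed by `code`. -/
def memory {F ι : Type*} [Field F] [DecidableEq F] (ω : F) (inp : ι → F)
    (code : List (Instr ι)) : List F :=
  code.foldl (fun mem ins => mem ++ [ins.eval ω inp mem]) []

theorem memory_concat {F ι : Type*} [Field F] [DecidableEq F] (ω : F) (inp : ι → F)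
    (code : List (Instr ι)) (ins : Instr ι) :
    memory ω inp (code ++ [ins]) =
      memory ω inp code ++ [ins.eval ω inp (memory ω inp code)] := by
  simp [memory]

theorem length_memory {F ι : Type*} [Field F] [DecidableEq F] (ω : F) (inp : ι → F)
    (code : List (Instr ι)) : (memory ω inp code).length = code.length := by
  induction code using List.reverseRecOn with
  | nil => rfl
  | append_singleton code ins ih => simp [memory_concat, ih]

theorem getD_memory_append {F ι : Type*} [Field F] [DecidableEq F] (ω : F) (inp : ι → F)
    (code ext : List (Instr ι)) {i : ℕ} (hi : i < code.length) :
    (memory ω inp (code ++ ext)).getD i 0 = (memory ω inp code).getD i 0 := by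
  induction ext using List.reverseRecOn with
  | nil => simp
  | append_singleton ext ins ih =>
    rw [← List.append_assoc, memory_concat, List.getD_append, ih]
    rw [length_memory, List.length_append]
    omega

variable (ω : ∀ x, F x) (inp : ∀ x, ι → F x)

/-- In every environment `x : E`, some fixed position of the memory holds `v x`. -/
def Available (code : List (Instr ι)) (v : ∀ x, F x) : Prop :=
  ∃ i < code.length, ∀ x, (memory (ω x) (inp x) code).getD i 0 = v x

variable {ω inp}

theorem Available.append {code : List (Instr ι)} {v : ∀ x, F x} (h : Available ω inp code v)
    (ext : List (Instr ι)) : Available ω inp (code ++ ext) v := by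
  obtain ⟨i, hi, h⟩ := h
  refine ⟨i, by rw [List.length_append]; omega, fun x => ?_⟩
  rw [getD_memory_append _ _ _ _ hi, h]

theorem available_concat (code : List (Instr ι)) (ins : Instr ι) :
    Available ω inp (code ++ [ins])
      (fun x => ins.eval (ω x) (inp x) (memory (ω x) (inp x) code)) := by
  refine ⟨code.length, by simp, fun x => ?_⟩
  rw [memory_concat, List.getD_append_right _ _ _ _ (by rw [length_memory])]
  simp [length_memory]

variable (ω inp)

/-- Code that has computed all values in `S` can be extended by at most `c` instructions to
compute all values in `T`. -/
def Derives (S : Set (∀ x, F x)) (c : ℕ) (T : Set (∀ x, F x)) : Prop :=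
  ∀ code, (∀ v ∈ S, Available ω inp code v) →
    ∃ ext : List (Instr ι), ext.length ≤ c ∧ ∀ v ∈ T, Available ω inp (code ++ ext) v

variable {ω inp} {S T U : Set (∀ x, F x)} {a b c d : ℕ} {t u v : ∀ x, F x}

theorem Derives.mono (h : Derives ω inp S c T) (hS : S ⊆ U) (hc : c ≤ d) :
    Derives ω inp U d T := fun code hcode =>
  have ⟨ext, h1, h2⟩ := h code fun v hv => hcode v (hS hv)
  ⟨ext, h1.trans hc, h2⟩

theorem Derives.subset (h : Derives ω inp S c T) (hT : U ⊆ T) : Derives ω inp S c U :=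
  fun code hcode =>
  have ⟨ext, h1, h2⟩ := h code hcode
  ⟨ext, h1, fun v hv => h2 v (hT hv)⟩

theorem Derives.of_subset (h : T ⊆ S) : Derives ω inp S 0 T := fun _ hcode =>
  ⟨[], le_rfl, fun v hv => (hcode v (h hv)).append []⟩

theorem Derives.trans (h : Derives ω inp S c T) (h' : Derives ω inp (S ∪ T) d U) :
    Derives ω inp S (c + d) U := fun code hcode => by
  obtain ⟨e1, h1, h2⟩ := h code hcode
  obtain ⟨e2, h3, h4⟩ := h' (code ++ e1) (by
    rintro v (hv | hv)
    exacts [(hcode v hv).append _, h2 v hv])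
  refine ⟨e1 ++ e2, by rw [List.length_append]; omega, fun v hv => ?_⟩
  rw [← List.append_assoc]
  exact h4 v hv

theorem Derives.union (h : Derives ω inp S c T) (h' : Derives ω inp S d U) :
    Derives ω inp S (c + d) (T ∪ U) := fun code hcode => by
  obtain ⟨e1, h1, h2⟩ := h code hcode
  obtain ⟨e2, h3, h4⟩ := h' (code ++ e1) fun v hv => (hcode v hv).append _
  refine ⟨e1 ++ e2, by rw [List.length_append]; omega, fun v hv => ?_⟩
  rw [← List.append_assoc]
  exact hv.elim (fun hv => (h2 v hv).append _) (fun hv => h4 v hv)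

/-- Chaining derivations while keeping the values obtained on the way. -/
theorem Derives.chain (h : Derives ω inp S c T) (h' : Derives ω inp (S ∪ T) d U) :
    Derives ω inp S (c + d) (T ∪ U) := by
  refine h.trans (Derives.mono (c := 0 + d) ?_ subset_rfl (by omega))
  exact (Derives.of_subset Set.subset_union_right).union h'

theorem Derives.iUnion {I : Type*} [Fintype I] {T : I → Set (∀ x, F x)}
    (h : ∀ i, Derives ω inp S c (T i)) :
    Derives ω inp S (Fintype.card I * c) (⋃ i, T i) := by
  classical
  have key : ∀ A : Finset I, Derives ω inp S (A.card * c) (⋃ i ∈ A, T i) := by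
    intro A
    induction A using Finset.induction_on with
    | empty => exact (Derives.of_subset (by simp)).mono subset_rfl (Nat.zero_le _)
    | insert i A hi ih =>
      rw [Finset.set_biUnion_insert, Finset.card_insert_of_notMem hi]
      exact ((h i).union ih).mono subset_rfl (by rw [Nat.add_mul]; omega)
  simpa using key Finset.univ

theorem Derives.range {I : Type*} [Fintype I] {f : I → ∀ x, F x}
    (h : ∀ i, Derives ω inp S c {f i}) :
    Derives ω inp S (Fintype.card I * c) (Set.range f) := by
  simpa using Derives.iUnion h

theorem Derives.of_mem (h : v ∈ S) : Derives ω inp S 0 {v} :=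
  Derives.of_subset (by simpa using h)

theorem Derives.input (i : ι) : Derives ω inp S 1 {fun x => inp x i} := fun code _ =>
  ⟨[.input i], le_rfl, by simpa [Instr.eval] using available_concat code (.input i)⟩

theorem Derives.const (z : ℤ) : Derives ω inp S 1 {fun x => (z : F x)} := fun code _ =>
  ⟨[.const z], le_rfl, by simpa [Instr.eval] using available_concat code (.const z)⟩

theorem Derives.root (e : ℕ) : Derives ω inp S 1 {ω ^ e} := fun code _ =>
  ⟨[.root e], le_rfl, by
    rintro _ rfl
    exact available_concat code (.root e)⟩

theorem Derives.binary (op : ℕ → ℕ → Instr ι) (g : ∀ x, F x → F x → F x)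
    (hop : ∀ i j x mem, (op i j).eval (ω x) (inp x) mem = g x (mem.getD i 0) (mem.getD j 0))
    (hu : Derives ω inp S a {u}) (hv : Derives ω inp S b {v}) :
    Derives ω inp S (a + b + 1) {fun x => g x (u x) (v x)} := by
  have h : Derives ω inp (S ∪ ({u} ∪ {v})) 1 {fun x => g x (u x) (v x)} := by
    intro code hcode
    obtain ⟨i, -, hi⟩ := hcode u (by simp)
    obtain ⟨j, -, hj⟩ := hcode v (by simp)
    refine ⟨[op i j], le_rfl, ?_⟩
    have := available_concat (ω := ω) (inp := inp) code (op i j)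
    simp only [hop, hi, hj] at this
    simpa using this
  exact (hu.union hv).trans h

theorem Derives.add (hu : Derives ω inp S a {u}) (hv : Derives ω inp S b {v}) :
    Derives ω inp S (a + b + 1) {u + v} :=
  .binary .add (fun _ => (· + ·)) (fun _ _ _ _ => rfl) hu hv

theorem Derives.sub (hu : Derives ω inp S a {u}) (hv : Derives ω inp S b {v}) :
    Derives ω inp S (a + b + 1) {u - v} :=
  .binary .sub (fun _ => (· - ·)) (fun _ _ _ _ => rfl) hu hv

theorem Derives.mul (hu : Derives ω inp S a {u}) (hv : Derives ω inp S b {v}) :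
    Derives ω inp S (a + b + 1) {u * v} :=
  .binary .mul (fun _ => (· * ·)) (fun _ _ _ _ => rfl) hu hv

theorem Derives.ifZero (ht : Derives ω inp S a {t}) (hu : Derives ω inp S b {u})
    (hv : Derives ω inp S c {v}) :
    Derives ω inp S (a + b + c + 1) {fun x => if t x = 0 then u x else v x} := by
  have h : Derives ω inp (S ∪ ({t} ∪ {u} ∪ {v})) 1
      {fun x => if t x = 0 then u x else v x} := by
    intro code hcode
    obtain ⟨i, -, hi⟩ := hcode t (by simp)
    obtain ⟨j, -, hj⟩ := hcode u (by simp)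
    obtain ⟨l, -, hl⟩ := hcode v (by simp)
    refine ⟨[.ifZero i j l], le_rfl, ?_⟩
    have := available_concat (ω := ω) (inp := inp) code (.ifZero i j l)
    simp only [Instr.eval, hi, hj, hl] at this
    simpa using this
  exact ((ht.union hu).union hv).trans h

theorem Derives.sum {I : Type*} (A : Finset I) {f : I → ∀ x, F x}
    (h : ∀ i ∈ A, Derives ω inp S c {f i}) :
    Derives ω inp S (A.card * (c + 1) + 1) {∑ i ∈ A, f i} := by
  classical
  induction A using Finset.induction_on with
  | empty =>
    have := Derives.const (ω := ω) (inp := inp) (S := S) 0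
    simp only [Int.cast_zero] at this
    exact this.mono subset_rfl (by simp)
  | insert i A hi ih =>
    rw [Finset.sum_insert hi, Finset.card_insert_of_notMem hi]
    refine ((h i (by simp)).add (ih fun j hj => h j (by simp [hj]))).mono subset_rfl ?_
    rw [Nat.add_mul]
    omega

/-- A linear transformation that acts on each of the `k` coordinates of an index separately. -/
theorem Derives.tensor {I C : Type} [Fintype I] [Fintype C] (A : I → C → C → ∀ x, F x) (k : ℕ)
    (f : I → (Fin k → C) → ∀ x, F x) (hA : ∀ i c a, A i c a ∈ S) (hf : ∀ i c, f i c ∈ S) :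
    Derives ω inp S
      (k * (Fintype.card I * Fintype.card C ^ k * (2 * Fintype.card C + 1)))
      (Set.range fun q : I × (Fin k → C) => ∑ a, (∏ j, A q.1 (q.2 j) (a j)) * f q.1 a) := by
  induction k generalizing I S with
  | zero =>
    refine (Derives.of_subset ?_).mono subset_rfl (Nat.zero_le _)
    rintro _ ⟨⟨i, c⟩, rfl⟩
    simpa using hf i default
  | succ k ih =>
    -- Yates' algorithm: the first coordinate of the argument is frozen and absorbed into the
    -- parameter type, which becomes `I × C`. The induction hypothesis transforms the other `k`
    -- coordinates, and one layer for coordinate 0 remains.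
    set h : (I × C) × (Fin k → C) → ∀ x, F x := fun (q : (I × C) × (Fin k → C)) =>
      ∑ a, (∏ j, A q.1.1 (q.2 j) (a j)) * f q.1.1 (Fin.cons q.1.2 a) with hh
    have h1 := ih (I := I × C) (S := S) (fun q : I × C => A q.1) (fun (q : I × C) a => f q.1 (Fin.cons q.2 a))
      (fun (q : I × C) => hA q.1) (fun (q : I × C) c => hf q.1 _)
    have h2 : Derives ω inp (S ∪ Set.range h)
        (Fintype.card (I × (Fin (k + 1) → C)) * (2 * Fintype.card C + 1))
        (Set.range fun q : I × (Fin (k + 1) → C) =>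
          ∑ a, (∏ j, A q.1 (q.2 j) (a j)) * f q.1 a) := by
      refine Derives.range fun q => ?_
      have e : ∑ a, (∏ j, A q.1 (q.2 j) (a j)) * f q.1 a =
          ∑ a0 : C, A q.1 (q.2 0) a0 * h ((q.1, a0), Fin.tail q.2) := by
        rw [← (Fin.consEquiv fun _ : Fin (k + 1) => C).sum_comp, Fintype.sum_prod_type]
        refine Finset.sum_congr rfl fun a0 _ => ?_
        rw [hh, Finset.mul_sum]
        refine Finset.sum_congr rfl fun a _ => ?_
        simp [Fin.prod_univ_succ, Fin.consEquiv, Fin.tail, mul_assoc]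
      rw [e]
      refine (Derives.sum (c := 0 + 0 + 1) _ fun a0 _ => ?_).mono subset_rfl (by
        rw [Finset.card_univ]; omega)
      exact (Derives.of_mem (.inl (hA _ _ _))).mul (Derives.of_mem (.inr ⟨_, rfl⟩))
    refine (h1.trans h2).mono subset_rfl (le_of_eq ?_)
    simp only [Fintype.card_prod, Fintype.card_pi, Finset.prod_const, Finset.card_univ,
      Fintype.card_fin]
    ring

theorem sum_range_two_mul {M : Type*} [AddCommMonoid M] (f : ℕ → M) (n : ℕ) :
    ∑ j ∈ Finset.range (2 * n), f j =
      ∑ j ∈ Finset.range n, f (2 * j) + ∑ j ∈ Finset.range n, f (2 * j + 1) := by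
  induction n with
  | zero => simp
  | succ n ih =>
    rw [show 2 * (n + 1) = 2 * n + 1 + 1 by ring, Finset.sum_range_succ, Finset.sum_range_succ, ih,
      Finset.sum_range_succ, Finset.sum_range_succ]
    abel

/-- The fast Fourier transform of length `2 ^ q`. -/
theorem Derives.fft {I : Type*} [Fintype I] (q r : ℕ) (hω : ω ^ (r * 2 ^ q) = 1)
    (f : I → ℕ → ∀ x, F x) (hf : ∀ i, ∀ j < 2 ^ q, f i j ∈ S) :
    Derives ω inp S (q * (Fintype.card I * 2 ^ q * 3))
      (Set.range fun t : I × Fin (2 ^ q) =>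
        ∑ j ∈ Finset.range (2 ^ q), ω ^ (r * (j * t.2)) * f t.1 j) := by
  induction q generalizing I S r with
  | zero =>
    refine (Derives.of_subset ?_).mono subset_rfl (Nat.zero_le _)
    rintro _ ⟨⟨i, c⟩, rfl⟩
    simpa using hf i 0 (by simp)
  | succ q ih =>
    -- Cooley–Tukey: the parity of the summation index joins the parameter type, and both halves are
    -- transforms of length `2 ^ q` for the root `ω ^ (2 * r)`.
    set h : (I × Fin 2) × Fin (2 ^ q) → ∀ x, F x := fun t =>
      ∑ j ∈ Finset.range (2 ^ q), ω ^ (2 * r * (j * t.2)) * f t.1.1 (2 * j + t.1.2) with hh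
    have h1 := ih (2 * r) (by rw [← hω]; ring_nf)
      (fun (q : I × Fin 2) j => f q.1 (2 * j + q.2)) (fun t j hj => hf t.1 _ (by
        have := t.2.2
        rw [pow_succ]
        omega))
    have h2 : Derives ω inp (S ∪ Set.range h)
        (Fintype.card (I × Fin (2 ^ (q + 1))) * 3)
        (Set.range fun t : I × Fin (2 ^ (q + 1)) =>
          ∑ j ∈ Finset.range (2 ^ (q + 1)), ω ^ (r * (j * t.2)) * f t.1 j) := by
      refine Derives.range fun ⟨i, m⟩ => ?_
      -- The half-length transforms are periodic in the output index with period `2 ^ q`.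
      let m' : Fin (2 ^ q) := ⟨m % 2 ^ q, Nat.mod_lt _ (by positivity)⟩
      have hm (j : ℕ) : ω ^ (2 * r * (j * m)) = ω ^ (2 * r * (j * m')) := by
        conv_lhs => rw [← Nat.mod_add_div (m : ℕ) (2 ^ q)]
        rw [show 2 * r * (j * (m % 2 ^ q + 2 ^ q * (m / 2 ^ q))) =
          2 * r * (j * (m % 2 ^ q)) + (r * 2 ^ (q + 1)) * (j * (m / 2 ^ q)) by ring,
          pow_add, pow_mul _ (r * 2 ^ (q + 1)), hω, one_pow, mul_one]
      have e : ∑ j ∈ Finset.range (2 ^ (q + 1)), ω ^ (r * (j * m)) * f i j =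
          h ((i, 0), m') + ω ^ (r * m) * h ((i, 1), m') := by
        have e2 : Finset.range (2 ^ (q + 1)) = Finset.range (2 * 2 ^ q) := by rw [pow_succ']
        rw [e2, sum_range_two_mul, hh]
        simp only [← hm, Finset.mul_sum]
        congr 1 <;> refine Finset.sum_congr rfl fun j _ => ?_
        · simp only [Fin.coe_ofNat_eq_mod]
          ring_nf
        · simp only [Fin.coe_ofNat_eq_mod, Nat.one_mod]
          rw [← mul_assoc (ω ^ _), ← pow_add]
          congr 2
          ring
      simp only [e]
      exact (Derives.of_mem (.inr ⟨_, rfl⟩)).add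
        ((Derives.root _).mul (Derives.of_mem (.inr ⟨_, rfl⟩)))
    refine (h1.trans h2).mono subset_rfl (le_of_eq ?_)
    simp only [Fintype.card_prod, Fintype.card_fin]
    ring

end Derivations

/-! ### Diagonalising the addition of labels -/

section Transform

variable {K : Type*} [Field K]

theorem IsPrimitiveRoot.sum_pow_mul {ζ : K} {n : ℕ} (h : IsPrimitiveRoot ζ n) (t : ℕ) :
    ∑ j ∈ Finset.range n, ζ ^ (j * t) = if n ∣ t then (n : K) else 0 := by
  split_ifs with ht
  · rw [Finset.sum_congr rfl fun j _ => (h.pow_eq_one_iff_dvd _).2 (Dvd.dvd.mul_left ht j)]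
    simp
  · have h1 : ζ ^ t ≠ 1 := fun h1 => ht ((h.pow_eq_one_iff_dvd t).1 h1)
    have h2 := mul_neg_geom_sum (ζ ^ t) n
    rw [← pow_mul, mul_comm t n, pow_mul, h.pow_eq_one, one_pow, sub_self] at h2
    simp_rw [mul_comm _ t, pow_mul]
    exact (mul_eq_zero.1 h2).resolve_left (sub_ne_zero.2 h1.symm)

/-- The sum over all roots of unity `ε` of order `k + 1` extracts the constant term of a product
of `k` linear polynomials in `ε`. -/
theorem IsPrimitiveRoot.sum_prod_add_mul {ε : K} {k : ℕ} (h : IsPrimitiveRoot ε (k + 1))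
    (t w : Fin k → K) :
    ∑ e ∈ Finset.range (k + 1), ∏ j, (t j + ε ^ e * w j) = (k + 1) * ∏ j, t j := by
  have h1 : ∀ e, ∏ j, (t j + ε ^ e * w j) = ∑ A ∈ (Finset.univ : Finset (Fin k)).powerset,
      ε ^ (e * A.card) * ((∏ j ∈ A, w j) * ∏ j ∈ Finset.univ \ A, t j) := by
    intro e
    rw [Finset.prod_congr rfl fun j _ => add_comm (t j) _, Finset.prod_add]
    refine Finset.sum_congr rfl fun A _ => ?_
    rw [Finset.prod_mul_distrib, Finset.prod_const, pow_mul, mul_assoc]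
  simp_rw [h1]
  rw [Finset.sum_comm]
  simp_rw [← Finset.sum_mul, IsPrimitiveRoot.sum_pow_mul h]
  -- Orthogonality leaves the subsets whose size is divisible by `k + 1`; sizes are at most `k`, so
  -- only the empty set survives.
  rw [Finset.sum_eq_single ∅]
  · simp
  · intro A _ hA
    rw [if_neg, zero_mul]
    intro hd
    have := Nat.le_of_dvd (Finset.card_pos.2 (Finset.nonempty_iff_ne_empty.2 hA)) hd
    have := A.card_le_univ
    simp at this
    omega
  · simp

/-- The matrix that evaluates a table on the labels of one type. Row `b < L` evaluates a polynomial
in `x` at the point `η ^ (e + (k + 1) * b)`; for the `e`-th deformation of `K[x] / x ^ L`, these are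
the points with `x ^ L = (η ^ L) ^ e`. If there is a label with number `L`, then it stands for all
numbers that are at least `L`, and row `L` sums up the whole table. -/
def evalEntry (η : K) (k L e b a : ℕ) : K :=
  if b < L then if a < L then η ^ ((e + (k + 1) * b) * a) else 0 else 1

/-- The entries that interpolate the coefficients of the numbers below `L`. -/
def lowEntry (η : K) (k L e c b : ℕ) : K := η ^ ((e + (k + 1) * b) * (((k + 1) * L - 1) * c))

/-- The matrix that interpolates a table from its evaluation, scaled by `max L 1`. -/
def interpEntry (η : K) (k L e c b : ℕ) : K :=
  if c < L then if b < L then lowEntry η k L e c b else 0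
  else if b < L then -∑ c' ∈ Finset.range L, lowEntry η k L e c' b else (max L 1 : ℕ)

/-- Addition of the numbers of two labels of one type. -/
def joinEntry (K : Type*) [Field K] (L c a a' : ℕ) : K :=
  if c < L then if a + a' = c then 1 else 0 else if L ≤ a + a' then 1 else 0

/-- The part of a sum that wraps around. -/
def wrapEntry (K : Type*) [Field K] (L c a a' : ℕ) : K :=
  if c < L then if a < L ∧ a' < L ∧ a + a' = c + L then 1 else 0
  else -∑ c' ∈ Finset.range L, if a < L ∧ a' < L ∧ a + a' = c' + L then 1 else 0

/-- This is an inverse Fourier transform on a coset: the points `η ^ (e + (k + 1) * b)` are the `L`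
roots of x^L = (η^L)^e. Modulo this relation x^(a+a') is reduced at most once, since `a + a' < 2 *
L`, and that reduction contributes the factor `(η ^ L) ^ e`. -/
theorem sum_low {η : K} {k L : ℕ} (hL : 0 < L) (h : IsPrimitiveRoot η ((k + 1) * L))
    (e : ℕ) {a a' c : ℕ} (hc : c < L) :
    ∑ b ∈ Finset.range L, lowEntry η k L e c b * evalEntry η k L e b a *
      evalEntry η k L e b a' =
    L * ((if a < L ∧ a' < L ∧ a + a' = c then 1 else 0) +
      (η ^ L) ^ e * if a < L ∧ a' < L ∧ a + a' = c + L then 1 else 0) := by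
  by_cases ha : a < L ∧ a' < L
  swap
  · rw [if_neg (by tauto), if_neg (by tauto), Finset.sum_eq_zero]
    · simp
    · intro b hb
      rw [Finset.mem_range] at hb
      simp only [evalEntry, if_pos hb]
      by_cases h1 : a < L
      · rw [if_neg (show ¬ a' < L by tauto), mul_zero]
      · rw [if_neg h1, mul_zero, zero_mul]
  set Q := (k + 1) * L with hQ
  have hQL : L ≤ Q := Nat.le_mul_of_pos_left _ (Nat.succ_pos k)
  -- Since `η ^ Q = 1`, this is the exponent `a + a' - c` without subtraction.
  set u := a + a' + (Q - 1) * c with hu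
  have huc : u + c = a + a' + Q * c := by
    obtain ⟨Q', hQ'⟩ : ∃ Q', Q = Q' + 1 := ⟨Q - 1, by omega⟩
    rw [hu, hQ', Nat.add_sub_cancel]
    ring
  have hζ : IsPrimitiveRoot (η ^ (k + 1)) L := h.pow (by positivity) rfl
  have h1 : ∑ b ∈ Finset.range L, lowEntry η k L e c b * evalEntry η k L e b a *
      evalEntry η k L e b a' = η ^ (e * u) * if L ∣ u then (L : K) else 0 := by
    rw [← IsPrimitiveRoot.sum_pow_mul hζ, Finset.mul_sum]
    refine Finset.sum_congr rfl fun b hb => ?_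
    rw [Finset.mem_range] at hb
    simp only [evalEntry, lowEntry, if_pos hb, if_pos ha.1, if_pos ha.2, ← pow_add, ← pow_mul,
      ← hQ]
    congr 1
    rw [hu]
    ring
  have hLQ : L ∣ Q * c := Dvd.dvd.mul_right (Dvd.intro_left _ rfl) c
  have hdvd : L ∣ u ↔ a + a' = c ∨ a + a' = c + L := by
    have h2 : Q * c = L * ((k + 1) * c) := by rw [hQ]; ring
    constructor
    · rintro ⟨w, hw⟩
      rw [hw, h2] at huc
      -- `a + a' - c` lies strictly between `-L` and `2 * L`, so the only possible multiples of `L`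
      -- are `0` and `L`.
      zify at huc ha hc hL ⊢
      have h3 : (a + a' - c : ℤ) = L * (w - (k + 1) * c) := by linarith
      generalize (w - (k + 1) * c : ℤ) = d at h3
      have h4 : -1 < d := by
        by_contra hd
        nlinarith
      have h5 : d < 2 := by
        by_contra hd
        nlinarith
      obtain rfl | rfl : d = 0 ∨ d = 1 := by omega
      · left; linarith
      · right; linarith
    · rintro (h3 | h3)
      · exact (show u = Q * c by omega) ▸ hLQ
      · exact (show u = Q * c + L by omega) ▸ hLQ.add dvd_rfl
  have hone : η ^ Q = 1 := h.pow_eq_one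
  rw [h1]
  by_cases h3 : a + a' = c
  · rw [if_pos (hdvd.2 (.inl h3)), if_pos ⟨ha.1, ha.2, h3⟩, if_neg (by omega),
      show u = Q * c by omega, show e * (Q * c) = Q * (c * e) by ring, pow_mul, hone]
    simp
  by_cases h4 : a + a' = c + L
  · rw [if_pos (hdvd.2 (.inr h4)), if_neg (by omega), if_pos ⟨ha.1, ha.2, h4⟩,
      show u = Q * c + L by omega, show e * (Q * c + L) = Q * (c * e) + L * e by ring, pow_add,
      pow_mul, hone, pow_mul]
    simp [← pow_mul, mul_comm]
  · rw [if_neg (by rw [hdvd]; tauto), if_neg (by tauto), if_neg (by tauto)]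
    simp

/-- `L = l + 1` is the finite case, in which every label is exact. `L = l` is the cofinite case:
summing the whole table is one more multiplicative functional, and the last label is recovered as
this total minus all the exact coefficients. -/
theorem sum_interpEntry {η : K} {k L l : ℕ} (hl : L = l ∨ L = l + 1)
    (h : IsPrimitiveRoot η ((k + 1) * max L 1)) (e : ℕ) {a a' c : ℕ} (ha : a ≤ l) (ha' : a' ≤ l)
    (hc : c ≤ l) :
    ∑ b : Fin (l + 1), interpEntry η k L e c b * evalEntry η k L e b a *
      evalEntry η k L e b a' =
    (max L 1 : ℕ) * (joinEntry K L c a a' + (η ^ max L 1) ^ e * wrapEntry K L c a a') := by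
  rw [Fin.sum_univ_eq_sum_range (fun b => interpEntry η k L e c b * evalEntry η k L e b a *
      evalEntry η k L e b a') (l + 1)]
  -- `L = 0` is the case τ = ℕ with the single label |≥0|; then there are no points and the scale is
  -- `max 0 1 = 1`.
  obtain rfl | hL := Nat.eq_zero_or_pos L
  · obtain rfl | h0 := hl
    · simp [interpEntry, evalEntry, joinEntry, wrapEntry]
    · omega
  have hmax : max L 1 = L := by omega
  rw [hmax] at h ⊢
  by_cases hcL : c < L
  · have h1 : ∑ b ∈ Finset.range (l + 1), interpEntry η k L e c b * evalEntry η k L e b a *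
        evalEntry η k L e b a' = ∑ b ∈ Finset.range L, lowEntry η k L e c b *
        evalEntry η k L e b a * evalEntry η k L e b a' := by
      rw [← Finset.sum_subset (Finset.range_subset_range.2 (show L ≤ l + 1 by omega))]
      · refine Finset.sum_congr rfl fun b hb => ?_
        rw [Finset.mem_range] at hb
        simp [interpEntry, hcL, hb]
      · intro b _ hb
        rw [Finset.mem_range] at hb
        simp [interpEntry, hcL, hb]
    rw [h1, sum_low hL h e hcL, joinEntry, wrapEntry, if_pos hcL, if_pos hcL]
    have h2 : (a < L ∧ a' < L ∧ a + a' = c) ↔ a + a' = c := by omega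
    simp only [h2]
  · obtain rfl : c = L := by omega
    obtain rfl : c = l := by omega
    have h1 : ∀ b ∈ Finset.range c, interpEntry η k c e c b * evalEntry η k c e b a *
        evalEntry η k c e b a' = -∑ c' ∈ Finset.range c, lowEntry η k c e c' b *
        evalEntry η k c e b a * evalEntry η k c e b a' := by
      intro b hb
      rw [Finset.mem_range] at hb
      simp only [interpEntry, if_neg hcL, if_pos hb, neg_mul, Finset.sum_mul]
    rw [Finset.sum_range_succ, Finset.sum_congr rfl h1, Finset.sum_neg_distrib, Finset.sum_comm,
      Finset.sum_congr rfl fun c' hc' => sum_low hL h e (Finset.mem_range.1 hc')]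
    simp only [interpEntry, evalEntry, joinEntry, wrapEntry, lt_irrefl, if_false, hmax, mul_one]
    rw [← Finset.mul_sum, Finset.sum_add_distrib, ← Finset.mul_sum]
    have h2 : (∑ c' ∈ Finset.range c, if a < c ∧ a' < c ∧ a + a' = c' then (1 : K) else 0) =
        1 - if c ≤ a + a' then 1 else 0 := by
      by_cases h3 : c ≤ a + a'
      · rw [if_pos h3, sub_self]
        refine Finset.sum_eq_zero fun c' hc' => if_neg ?_
        rw [Finset.mem_range] at hc'
        omega
      · rw [if_neg h3, sub_zero, Finset.sum_eq_single (a + a')]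
        · exact if_pos ⟨by omega, by omega, rfl⟩
        · exact fun c' _ hc' => if_neg fun h4 => hc' h4.2.2.symm
        · exact fun h4 => absurd (Finset.mem_range.2 (by omega)) h4
    rw [h2]
    ring

variable {l₁ l₂ : ℕ}

/-- The block diagonal matrix that evaluates a table at all labels. -/
def evalMatrix (η₁ η₂ : K) (k L₁ L₂ e : ℕ) :
    Fin (l₁ + 1) ⊕ Fin (l₂ + 1) → Fin (l₁ + 1) ⊕ Fin (l₂ + 1) → K
  | .inl b, .inl a => evalEntry η₁ k L₁ e b a
  | .inr b, .inr a => evalEntry η₂ k L₂ e b a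
  | _, _ => 0

/-- The block diagonal matrix that interpolates a table at all labels. -/
def interpMatrix (η₁ η₂ : K) (k L₁ L₂ e : ℕ) :
    Fin (l₁ + 1) ⊕ Fin (l₂ + 1) → Fin (l₁ + 1) ⊕ Fin (l₂ + 1) → K
  | .inl c, .inl b => interpEntry η₁ k L₁ e c b
  | .inr c, .inr b => interpEntry η₂ k L₂ e c b
  | _, _ => 0

/-- The factor by which the interpolated value of a label is scaled. -/
def labelScale (L₁ L₂ : ℕ) : Fin (l₁ + 1) ⊕ Fin (l₂ + 1) → ℕ
  | .inl _ => max L₁ 1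
  | .inr _ => max L₂ 1

/-- Addition of labels as a zero-one tensor. -/
def joinTensor (K : Type*) [Field K] (L₁ L₂ : ℕ) :
    Fin (l₁ + 1) ⊕ Fin (l₂ + 1) → Fin (l₁ + 1) ⊕ Fin (l₂ + 1) → Fin (l₁ + 1) ⊕ Fin (l₂ + 1) → K
  | .inl c, .inl a, .inl a' => joinEntry K L₁ c a a'
  | .inr c, .inr a, .inr a' => joinEntry K L₂ c a a'
  | _, _, _ => 0

/-- The terms that wrap around when labels are added. -/
def wrapTensor (K : Type*) [Field K] (L₁ L₂ : ℕ) :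
    Fin (l₁ + 1) ⊕ Fin (l₂ + 1) → Fin (l₁ + 1) ⊕ Fin (l₂ + 1) → Fin (l₁ + 1) ⊕ Fin (l₂ + 1) → K
  | .inl c, .inl a, .inl a' => wrapEntry K L₁ c a a'
  | .inr c, .inr a, .inr a' => wrapEntry K L₂ c a a'
  | _, _, _ => 0

variable {η₁ η₂ ε : K} {k L₁ L₂ : ℕ}

/-- Both blocks are deformed by the same `ε`, so that colourings with labels of both types depend on
a single parameter `ε ^ e`. -/
theorem sum_interpMatrix (hl₁ : L₁ = l₁ ∨ L₁ = l₁ + 1) (hl₂ : L₂ = l₂ ∨ L₂ = l₂ + 1)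
    (h₁ : IsPrimitiveRoot η₁ ((k + 1) * max L₁ 1)) (h₂ : IsPrimitiveRoot η₂ ((k + 1) * max L₂ 1))
    (hε₁ : η₁ ^ max L₁ 1 = ε) (hε₂ : η₂ ^ max L₂ 1 = ε) (e : ℕ)
    (c a a' : Fin (l₁ + 1) ⊕ Fin (l₂ + 1)) :
    ∑ b, interpMatrix η₁ η₂ k L₁ L₂ e c b * evalMatrix η₁ η₂ k L₁ L₂ e b a *
      evalMatrix η₁ η₂ k L₁ L₂ e b a' =
    labelScale L₁ L₂ c * (joinTensor K L₁ L₂ c a a' + ε ^ e * wrapTensor K L₁ L₂ c a a') := by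
  rw [Fintype.sum_sum_type]
  rcases c with c | c <;> rcases a with a | a <;> rcases a' with a' | a' <;>
    simp only [interpMatrix, evalMatrix, joinTensor, wrapTensor, zero_mul, mul_zero,
      Finset.sum_const_zero, add_zero, zero_add, labelScale]
  · rw [sum_interpEntry hl₁ h₁ e (Nat.lt_succ_iff.1 a.2) (Nat.lt_succ_iff.1 a'.2)
      (Nat.lt_succ_iff.1 c.2), hε₁]
  · rw [sum_interpEntry hl₂ h₂ e (Nat.lt_succ_iff.1 a.2) (Nat.lt_succ_iff.1 a'.2)
      (Nat.lt_succ_iff.1 c.2), hε₂]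

/-- A coordinatewise change of basis diagonalises any bilinear product that it diagonalises in
each coordinate. -/
theorem sum_prod_interp {C : Type*} [Fintype C] (A B : C → C → K) (T : C → C → C → K)
    (h : ∀ c a a', ∑ b, B c b * A b a * A b a' = T c a a') (f g : (Fin k → C) → K)
    (c : Fin k → C) :
    ∑ b : Fin k → C, (∏ j, B (c j) (b j)) *
      ((∑ a, (∏ j, A (b j) (a j)) * f a) * ∑ a', (∏ j, A (b j) (a' j)) * g a') =
    ∑ a, ∑ a', (∏ j, T (c j) (a j) (a' j)) * (f a * g a') := by
  classical
  simp_rw [← h, Finset.prod_univ_sum, Fintype.piFinset_univ, Finset.sum_mul, Finset.mul_sum,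
    Finset.prod_mul_distrib]
  rw [Finset.sum_comm]
  refine Finset.sum_congr rfl fun a _ => ?_
  rw [Finset.sum_comm]
  refine Finset.sum_congr rfl fun a' _ => Finset.sum_congr rfl fun b _ => ?_
  ring

/-- Summing over the `k + 1` deformations cancels every term containing a wrapped coordinate. The
scale factor is kept, because only the vanishing of the result will matter. -/
theorem sum_sum_prod_interpMatrix (hl₁ : L₁ = l₁ ∨ L₁ = l₁ + 1) (hl₂ : L₂ = l₂ ∨ L₂ = l₂ + 1)
    (h₁ : IsPrimitiveRoot η₁ ((k + 1) * max L₁ 1)) (h₂ : IsPrimitiveRoot η₂ ((k + 1) * max L₂ 1))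
    (hε₁ : η₁ ^ max L₁ 1 = ε) (hε₂ : η₂ ^ max L₂ 1 = ε)
    (f g : (Fin k → Fin (l₁ + 1) ⊕ Fin (l₂ + 1)) → K) (c : Fin k → Fin (l₁ + 1) ⊕ Fin (l₂ + 1)) :
    ∑ e ∈ Finset.range (k + 1), ∑ b : Fin k → Fin (l₁ + 1) ⊕ Fin (l₂ + 1),
      (∏ j, interpMatrix η₁ η₂ k L₁ L₂ e (c j) (b j)) *
      ((∑ a, (∏ j, evalMatrix η₁ η₂ k L₁ L₂ e (b j) (a j)) * f a) *
        ∑ a', (∏ j, evalMatrix η₁ η₂ k L₁ L₂ e (b j) (a' j)) * g a') =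
    ((k + 1) * ∏ j, (labelScale L₁ L₂ (c j) : K)) *
      ∑ a, ∑ a', (∏ j, joinTensor K L₁ L₂ (c j) (a j) (a' j)) * (f a * g a') := by
  have hε : IsPrimitiveRoot ε (k + 1) := hε₁ ▸ h₁.pow (by positivity) (mul_comm _ _)
  rw [Finset.sum_congr rfl fun e _ => sum_prod_interp _ _ _
    (sum_interpMatrix hl₁ hl₂ h₁ h₂ hε₁ hε₂ e) f g c]
  rw [Finset.sum_comm, Finset.mul_sum]
  refine Finset.sum_congr rfl fun a _ => ?_
  rw [Finset.sum_comm, Finset.mul_sum]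
  refine Finset.sum_congr rfl fun a' _ => ?_
  rw [← Finset.sum_mul, ← mul_assoc]
  simp_rw [Finset.prod_mul_distrib]
  rw [← Finset.mul_sum, IsPrimitiveRoot.sum_prod_add_mul hε]
  ring

end Transform

/-! ### Counting the pairs of colourings with a given join and a given total value -/

section Counting

variable {K : Type*} [Field K] {σ ρ : Set ℕ} {k : ℕ}

/-- The number of labels in `C_τ` that stand for a single number. -/
noncomputable def numExact (τ : Set ℕ) : ℕ :=
  open scoped Classical in if τ.Finite then lastLabel τ + 1 else lastLabel τ

theorem numExact_eq (τ : Set ℕ) :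
    numExact τ = lastLabel τ ∨ numExact τ = lastLabel τ + 1 := by
  unfold numExact
  split_ifs <;> simp

open scoped Classical in
theorem joinEntry_numExact (τ : Set ℕ) (c a a' : Fin (lastLabel τ + 1)) :
    joinEntry K (numExact τ) c a a' = if HasLabel τ c (a + a') then 1 else 0 := by
  have := c.2
  by_cases h : τ.Finite
  · simp only [joinEntry, numExact, HasLabel, h, if_true, c.2, not_true_eq_false, false_and,
      or_false]
  · simp only [joinEntry, numExact, HasLabel, h, if_false, not_false_eq_true, true_and]
    by_cases hc : (c : ℕ) < lastLabel τ
    · rw [if_pos hc]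
      exact if_congr (by omega) rfl rfl
    · rw [if_neg hc]
      exact if_congr (by omega) rfl rfl

open scoped Classical in
theorem joinTensor_numExact (c a a' : Label σ ρ) :
    joinTensor K (numExact σ) (numExact ρ) c a a' = if LabelJoin a a' c then 1 else 0 := by
  rcases c with c | c <;> rcases a with a | a <;> rcases a' with a' | a' <;>
    simp [joinTensor, LabelJoin, joinEntry_numExact]
  all_goals congr

/-- The values of all pairs of table entries that contribute to one entry of the join. -/
def joinValues (Al Ar : Table σ ρ k) (c : Colouring σ ρ k) : Set ℕ :=
  {m | ∃ (cl cr : Colouring σ ρ k) (a b : ℕ),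
    (∀ j, LabelJoin (cl j) (cr j) (c j)) ∧ Al cl = some a ∧ Ar cr = some b ∧ m = a + b}

/-- The value at `z ^ j` of the monomial that represents a table entry. -/
def monomialValue (z : K) : Option ℕ → ℕ → K
  | none, _ => 0
  | some a, j => z ^ (a * j)

/-- Orthogonality of characters, with `θ ^ (N - 1)` as the inverse of `θ`. Both `m` and `a + b` are
below `N`, so congruence modulo `N` is equality. -/
theorem sum_monomialValue {θ : K} {N : ℕ} (hθ : IsPrimitiveRoot θ N) {m a b : ℕ}
    (hm : m < N) (hab : a + b < N) :
    ∑ j ∈ Finset.range N, θ ^ (j * m) *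
      (monomialValue (θ ^ (N - 1)) (some a) j * monomialValue (θ ^ (N - 1)) (some b) j) =
    if m = a + b then (N : K) else 0 := by
  have h : ∀ j, θ ^ (j * m) *
      (monomialValue (θ ^ (N - 1)) (some a) j * monomialValue (θ ^ (N - 1)) (some b) j) =
      θ ^ (j * (m + (N - 1) * (a + b))) := by
    intro j
    simp only [monomialValue, ← pow_mul, ← pow_add]
    congr 1
    ring
  simp_rw [h]
  rw [IsPrimitiveRoot.sum_pow_mul hθ]
  refine if_congr ?_ rfl rfl
  obtain ⟨N', rfl⟩ : ∃ N', N = N' + 1 := ⟨N - 1, by omega⟩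
  rw [Nat.add_sub_cancel]
  generalize a + b = u at *
  have key : m + N' * u + u = m + (N' + 1) * u := by ring
  constructor
  · rintro ⟨w, hw⟩
    rw [hw] at key
    zify at key hm hab ⊢
    have h3 : (m - u : ℤ) = (N' + 1) * (w - u) := by linarith
    generalize (w - u : ℤ) = d at h3
    have h4 : -1 < d := by
      by_contra hd
      nlinarith
    have h5 : d < 1 := by
      by_contra hd
      nlinarith
    obtain rfl : d = 0 := by omega
    linarith
  · rintro rfl
    exact ⟨m, by ring⟩

open scoped Classical in
/-- The pairs of colourings with join `c` and total value `m`. -/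
noncomputable def joinPairs (Al Ar : Table σ ρ k) (c : Colouring σ ρ k) (m : ℕ) :
    Finset (Colouring σ ρ k × Colouring σ ρ k) :=
  {q | (∀ j, LabelJoin (q.1 j) (q.2 j) (c j)) ∧
    ∃ a b, Al q.1 = some a ∧ Ar q.2 = some b ∧ m = a + b}

theorem joinPairs_nonempty {Al Ar : Table σ ρ k} {c : Colouring σ ρ k} {m : ℕ} :
    (joinPairs Al Ar c m).Nonempty ↔ m ∈ joinValues Al Ar c := by
  simp only [Finset.Nonempty, joinPairs, Finset.mem_filter, Finset.mem_univ, true_and, joinValues,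
    Prod.exists, Set.mem_ofPred_eq]
  constructor
  · rintro ⟨cl, cr, h, a, b, h'⟩
    exact ⟨cl, cr, a, b, h, h'⟩
  · rintro ⟨cl, cr, a, b, h, h'⟩
    exact ⟨cl, cr, h, a, b, h'⟩

/-- Any larger characteristic keeps a positive count nonzero in the field. -/
theorem card_joinPairs_le (Al Ar : Table σ ρ k) (c : Colouring σ ρ k) (m : ℕ) :
    (joinPairs Al Ar c m).card ≤ numLabels σ ρ ^ (2 * k) := by
  refine (Finset.card_le_univ _).trans (le_of_eq ?_)
  simp [numLabels, two_mul, pow_add]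

/-- Fourier inversion in the value variable: the left side is `N` times the coefficient of X^m, and
total values are at most `2 * n < N`, so no two of them are confused. -/
theorem sum_joinTensor {θ : K} {N n : ℕ} (hθ : IsPrimitiveRoot θ N) {Al Ar : Table σ ρ k}
    (hAl : ∀ c, ∀ a ∈ Al c, a ≤ n) (hAr : ∀ c, ∀ a ∈ Ar c, a ≤ n) (hN : 2 * n < N)
    (c : Colouring σ ρ k) {m : ℕ} (hm : m ≤ 2 * n) :
    ∑ j ∈ Finset.range N, θ ^ (j * m) * ∑ a, ∑ a',
      (∏ i, joinTensor K (numExact σ) (numExact ρ) (c i) (a i) (a' i)) *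
        (monomialValue (θ ^ (N - 1)) (Al a) j * monomialValue (θ ^ (N - 1)) (Ar a') j) =
    N * (joinPairs Al Ar c m).card := by
  classical
  have h1 : ∀ a a' : Colouring σ ρ k,
      ∏ i, joinTensor K (numExact σ) (numExact ρ) (c i) (a i) (a' i) =
        if ∀ i, LabelJoin (a i) (a' i) (c i) then 1 else 0 := by
    intro a a'
    simp_rw [joinTensor_numExact]
    by_cases h : ∀ i, LabelJoin (a i) (a' i) (c i)
    · simp [h]
    · rw [if_neg h]
      obtain ⟨i, hi⟩ := not_forall.1 h
      exact Finset.prod_eq_zero (Finset.mem_univ i) (if_neg hi)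
  have h2 : ∀ q : Colouring σ ρ k × Colouring σ ρ k, ∑ j ∈ Finset.range N, θ ^ (j * m) *
      (monomialValue (θ ^ (N - 1)) (Al q.1) j * monomialValue (θ ^ (N - 1)) (Ar q.2) j) =
      if ∃ a b, Al q.1 = some a ∧ Ar q.2 = some b ∧ m = a + b then (N : K) else 0 := by
    rintro ⟨cl, cr⟩
    dsimp only
    rcases hl : Al cl with _ | a
    · simp [monomialValue]
    rcases hr : Ar cr with _ | b
    · simp [monomialValue]
    have := hAl _ a hl
    have := hAr _ b hr
    rw [sum_monomialValue hθ (by omega) (by omega)]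
    simp
  have h3 : ∀ j, ∑ a, ∑ a',
      (∏ i, joinTensor K (numExact σ) (numExact ρ) (c i) (a i) (a' i)) *
        (monomialValue (θ ^ (N - 1)) (Al a) j * monomialValue (θ ^ (N - 1)) (Ar a') j) =
      ∑ q : Colouring σ ρ k × Colouring σ ρ k,
        (if ∀ i, LabelJoin (q.1 i) (q.2 i) (c i) then 1 else 0) *
        (monomialValue (θ ^ (N - 1)) (Al q.1) j * monomialValue (θ ^ (N - 1)) (Ar q.2) j) := by
    intro j
    rw [Fintype.sum_prod_type]
    simp_rw [h1]
  simp_rw [h3, Finset.mul_sum]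
  rw [Finset.sum_comm]
  rw [joinPairs, Finset.card_filter, Nat.cast_sum, Finset.mul_sum]
  refine Finset.sum_congr rfl fun q _ => ?_
  rw [Finset.sum_congr rfl fun j _ => mul_left_comm _ _ _, ← Finset.mul_sum, h2]
  by_cases h4 : ∀ i, LabelJoin (q.1 i) (q.2 i) (c i) <;> simp [h4]

theorem optimum_minimise {S : Set ℕ} {m : ℕ} (h : IsLeast S m) :
    optimum .minimise S = some m := by
  rw [optimum, if_pos h.nonempty]
  exact congrArg some h.csInf_eq

theorem optimum_maximise {S : Set ℕ} {m : ℕ} (h : IsGreatest S m) :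
    optimum .maximise S = some m := by
  rw [optimum, if_pos h.nonempty]
  exact congrArg some h.csSup_eq

theorem optimum_empty (o : Objective) : optimum o ∅ = none := by
  simp [optimum]

/-- The representation of a table entry in an arbitrary field. -/
def embed (K : Type*) [Field K] : Option ℕ → K
  | none => -1
  | some m => (m : K)

end Counting

/-! ### Passing between table entries and monomials by tests for zero -/

section Selection

variable {ι E : Type*} {F : E → Type*} [∀ x, Field (F x)] [∀ x, DecidableEq (F x)]
  {ω : ∀ x, F x} {inp : ∀ x, ι → F x} {S : Set (∀ x, F x)}

/-- Searching the optimum of a set from its indicator function. -/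
theorem Derives.optimum (o : Objective) (B : ℕ) (f : ℕ → ∀ x, F x) (V : E → Set ℕ)
    (hV : ∀ x, ∀ m ∈ V x, m < B) (hf : ∀ m < B, f m ∈ S)
    (h : ∀ x, ∀ m < B, f m x ≠ 0 ↔ m ∈ V x) :
    Derives ω inp S (1 + 2 * B) {fun x => embed (F x) (SigmaRho.optimum o (V x))} := by
  have h0 : Derives ω inp S (1 + 2 * 0) {fun x => embed (F x) none} := by
    simpa [embed] using Derives.const (-1)
  cases o with
  | minimise =>
    -- Scan downwards from `B`, so that each smaller element found overrides the previous result;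
    -- for the maximum the scan goes upwards.
    have key : ∀ m ≤ B, Derives ω inp S (1 + 2 * m) {fun x =>
        embed (F x) (SigmaRho.optimum .minimise {v | v ∈ V x ∧ B - m ≤ v})} := by
      intro m
      induction m with
      | zero =>
        intro _
        convert h0 using 4 with x
        rw [show {v | v ∈ V x ∧ B - 0 ≤ v} = ∅ from ?_, optimum_empty]
        ext v
        simp only [Set.mem_ofPred_eq, Set.mem_empty_iff_false, iff_false, not_and]
        intro hv
        have := hV x v hv
        omega
      | succ m ih =>
        intro hm
        refine (Derives.ifZero (Derives.of_mem (hf (B - (m + 1)) (by omega))) (ih (by omega))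
          (Derives.const ((B - (m + 1) : ℕ) : ℤ))).mono subset_rfl (by omega) |>.subset ?_
        rw [Set.singleton_subset_iff, Set.mem_singleton_iff]
        ext x
        by_cases h1 : B - (m + 1) ∈ V x
        · rw [if_neg ((h x _ (by omega)).2 h1), optimum_minimise (m := B - (m + 1))]
          · simp [embed]
          · exact ⟨⟨h1, le_rfl⟩, fun v hv => hv.2⟩
        · rw [if_pos (by_contra fun h2 => h1 ((h x _ (by omega)).1 h2))]
          congr 3 with v
          constructor
          · rintro ⟨h2, h3⟩
            refine ⟨h2, ?_⟩
            have : v ≠ B - (m + 1) := fun h4 => h1 (h4 ▸ h2)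
            omega
          · rintro ⟨h2, h3⟩
            exact ⟨h2, by omega⟩
    simpa using key B le_rfl
  | maximise =>
    have key : ∀ m ≤ B, Derives ω inp S (1 + 2 * m) {fun x =>
        embed (F x) (SigmaRho.optimum .maximise {v | v ∈ V x ∧ v < m})} := by
      intro m
      induction m with
      | zero =>
        intro _
        convert h0 using 4 with x
        rw [show {v | v ∈ V x ∧ v < 0} = ∅ from ?_, optimum_empty]
        ext v
        simp
      | succ m ih =>
        intro hm
        refine (Derives.ifZero (Derives.of_mem (hf m (by omega))) (ih (by omega))
          (Derives.const (m : ℤ))).mono subset_rfl (by omega) |>.subset ?_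
        rw [Set.singleton_subset_iff, Set.mem_singleton_iff]
        ext x
        by_cases h1 : m ∈ V x
        · rw [if_neg ((h x _ (by omega)).2 h1), optimum_maximise (m := m)]
          · simp [embed]
          · exact ⟨⟨h1, Nat.lt_succ_self m⟩, fun v hv => Nat.lt_succ_iff.1 hv.2⟩
        · rw [if_pos (by_contra fun h2 => h1 ((h x _ (by omega)).1 h2))]
          congr 3 with v
          constructor
          · rintro ⟨h2, h3⟩
            refine ⟨h2, ?_⟩
            have : v ≠ m := fun h4 => h1 (h4 ▸ h2)
            omega
          · rintro ⟨h2, h3⟩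
            exact ⟨h2, by omega⟩
    refine (key B le_rfl).subset ?_
    rw [Set.singleton_subset_iff, Set.mem_singleton_iff]
    ext x
    congr 2 with v
    exact ⟨fun h1 => ⟨h1, hV x v h1⟩, fun h1 => h1.1⟩

/-- Raising a root of unity to the power given by a table entry, at the first `N` points. -/
theorem Derives.monomialValue (n N r : ℕ) (t : ∀ x, F x) (A : E → Option ℕ) (ht : t ∈ S)
    (htA : ∀ x, t x = embed (F x) (A x)) (hA : ∀ x, ∀ a ∈ A x, a ≤ n)
    (hF : ∀ x, ∀ m : ℕ, 0 < m → m ≤ n + 1 → (m : F x) ≠ 0) :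
    Derives ω inp S (4 * n + 10 + N)
      (Set.range fun j : Fin N => fun x => SigmaRho.monomialValue (ω x ^ r) (A x) j) := by
  set g : ℕ → ∀ x, F x := fun j x => SigmaRho.monomialValue (ω x ^ r) (A x) j with hg
  -- By `hF` the encodings `-1, 0, ..., n` are pairwise distinct in the field, so tests for zero
  -- identify the entry.
  have hnone : ∀ x, t x - ((-1 : ℤ) : F x) = 0 ↔ A x = none := by
    intro x
    rw [htA]
    rcases hx : A x with _ | a
    · simp [embed]
    · have := hF x (a + 1) (by omega) (by have := hA x a hx; omega)
      simpa [embed] using this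
  have hsome : ∀ x, ∀ m ≤ n, t x - ((m : ℤ) : F x) = 0 ↔ A x = some m := by
    intro x m hm
    rw [htA]
    rcases hx : A x with _ | a
    · have := hF x (m + 1) (by omega) (by omega)
      simp only [embed, reduceCtorEq, iff_false, Int.cast_natCast]
      intro h
      refine this ?_
      push_cast
      linear_combination -h
    · have ha := hA x a hx
      simp only [embed, Int.cast_natCast, Option.some.injEq]
      constructor
      · intro h
        by_contra hne
        rcases lt_or_gt_of_ne hne with h1 | h1
        · refine hF x (m - a) (by omega) (by omega) ?_
          rw [Nat.cast_sub h1.le]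
          linear_combination -h
        · refine hF x (a - m) (by omega) (by omega) ?_
          rw [Nat.cast_sub h1.le]
          exact h
      · rintro rfl
        simp
  have h0 : Derives ω inp S 5 {g 0} := by
    refine (((Derives.of_mem ht).sub (Derives.const (-1))).ifZero (Derives.const 0)
      (Derives.const 1)).mono subset_rfl (by omega) |>.subset ?_
    rw [Set.singleton_subset_iff, Set.mem_singleton_iff]
    ext x
    simp only [Pi.sub_apply, hnone, hg]
    rcases A x with _ | a <;> simp [SigmaRho.monomialValue]
  -- The exponent is known only as a field element, so it is compared with every `m ≤ n`; at most
  -- one comparison succeeds and selects the matching power.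
  have h1 : ∀ m ≤ n + 1, Derives ω inp S (1 + 4 * m) {fun x =>
      if ∃ a ∈ A x, a < m then g 1 x else 0} := by
    intro m
    induction m with
    | zero => exact fun _ => by simpa using Derives.const 0
    | succ m ih =>
      intro hm
      refine (((Derives.of_mem ht).sub (Derives.const (m : ℤ))).ifZero (Derives.root (r * m))
        (ih (by omega))).mono subset_rfl (by omega) |>.subset ?_
      rw [Set.singleton_subset_iff, Set.mem_singleton_iff]
      ext x
      simp only [Pi.sub_apply, hsome x m (by omega), hg]
      rcases A x with _ | a
      · simp
      · by_cases h2 : a = m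
        · simp [SigmaRho.monomialValue, h2, pow_mul]
        · have h3 : a ≤ m ↔ a < m := by omega
          simp [h2, h3]
  have h2 : Derives ω inp S (4 * n + 5) {g 1} := by
    refine (h1 (n + 1) le_rfl).mono subset_rfl (by omega) |>.subset ?_
    rw [Set.singleton_subset_iff, Set.mem_singleton_iff]
    ext x
    rcases hx : A x with _ | a
    · simp [hg, SigmaRho.monomialValue, hx]
    · have := hA x a hx
      simp [this]
  -- Each further point takes one multiplication by `g 1`, which keeps the cost at O(n + N) per
  -- entry rather than O(n N).
  have h3 : ∀ J, Derives ω inp (S ∪ ({g 0} ∪ {g 1})) J {v | ∃ j ≤ J, v = g j} := by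
    intro J
    induction J with
    | zero =>
      refine Derives.of_subset ?_
      rintro _ ⟨j, hj, rfl⟩
      obtain rfl := Nat.le_zero.1 hj
      simp
    | succ J ih =>
      have h4 : Derives ω inp ((S ∪ ({g 0} ∪ {g 1})) ∪ {v | ∃ j ≤ J, v = g j}) 1 {g (J + 1)} := by
        refine ((Derives.of_mem (v := g J) (.inr ⟨J, le_rfl, rfl⟩)).mul
          (Derives.of_mem (v := g 1) (by simp))).subset ?_
        rw [Set.singleton_subset_iff, Set.mem_singleton_iff]
        ext x
        simp only [hg, Pi.mul_apply]
        rcases A x with _ | a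
        · simp [SigmaRho.monomialValue]
        · simp only [SigmaRho.monomialValue, ← pow_add]
          congr 1
          ring
      refine (ih.chain h4).subset ?_
      rintro _ ⟨j, hj, rfl⟩
      rcases Nat.lt_or_ge J j with h5 | h5
      · obtain rfl : j = J + 1 := by omega
        exact .inr rfl
      · exact .inl ⟨j, h5, rfl⟩
  refine (((h0.union h2).trans (h3 N)).mono subset_rfl (by omega)).subset ?_
  rintro _ ⟨j, rfl⟩
  exact ⟨j, j.2.le, rfl⟩

end Selection

/-! ### The program that joins two tables -/

section JoinProgram

variable {ι E : Type*} {F : E → Type*} [∀ x, Field (F x)] [∀ x, DecidableEq (F x)]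
  {ω : ∀ x, F x} {inp : ∀ x, ι → F x} {S : Set (∀ x, F x)}

/-- Individual costs are needed for `Derives.interpMatrix`: charging every matrix entry its worst
cost would give order k s³, which exceeds s^(k+1) when k = 1. -/
theorem Derives.range_of_cost {I : Type*} [Fintype I] {f : I → ∀ x, F x} {c : I → ℕ}
    (h : ∀ i, Derives ω inp S (c i) {f i}) :
    Derives ω inp S (∑ i, c i) (Set.range f) := by
  classical
  have key : ∀ A : Finset I, Derives ω inp S (∑ i ∈ A, c i) (f '' A) := by
    intro A
    induction A using Finset.induction_on with
    | empty => exact (Derives.of_subset (by simp)).mono subset_rfl (Nat.zero_le _)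
    | insert i A hi ih =>
      rw [Finset.sum_insert hi, Finset.coe_insert, Set.image_insert_eq, Set.insert_eq]
      exact (h i).union ih
  simpa using key Finset.univ

/-- Evaluating a sum of bilinear products that are diagonal after a coordinatewise change of
basis. -/
theorem Derives.bilinear {H J C : Type} [Fintype H] [Fintype J] [Fintype C]
    (A B : H → C → C → ∀ x, F x) (k : ℕ) (f g : J → (Fin k → C) → ∀ x, F x)
    (hA : ∀ e c a, A e c a ∈ S) (hB : ∀ e c a, B e c a ∈ S)
    (hf : ∀ j c, f j c ∈ S) (hg : ∀ j c, g j c ∈ S) :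
    Derives ω inp S
      (3 * (k * (Fintype.card H * Fintype.card J * Fintype.card C ^ k * (2 * Fintype.card C + 1)))
        + 2 * (Fintype.card H * Fintype.card J * Fintype.card C ^ k)
        + Fintype.card J * Fintype.card C ^ k)
      (Set.range fun q : J × (Fin k → C) => ∑ e, ∑ b : Fin k → C, (∏ i, B e (q.2 i) (b i)) *
        ((∑ a, (∏ i, A e (b i) (a i)) * f q.1 a) * ∑ a, (∏ i, A e (b i) (a i)) * g q.1 a)) := by
  have h1 := Derives.tensor (ω := ω) (inp := inp) (S := S) (I := H × J) (fun t => A t.1) k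
    (fun t => f t.2) (fun t => hA t.1) (fun t => hf t.2)
  have h2 := Derives.tensor (ω := ω) (inp := inp) (S := S) (I := H × J) (fun t => A t.1) k
    (fun t => g t.2) (fun t => hA t.1) (fun t => hg t.2)
  -- In the transformed basis the product is pointwise, one multiplication per index.
  let w : (H × J) × (Fin k → C) → ∀ x, F x := fun q =>
    (∑ a, (∏ i, A q.1.1 (q.2 i) (a i)) * f q.1.2 a) *
      ∑ a, (∏ i, A q.1.1 (q.2 i) (a i)) * g q.1.2 a
  have h3 := (h1.union h2).trans (U := Set.range w) (Derives.range fun q =>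
    (Derives.of_mem (.inr (.inl ⟨q, rfl⟩))).mul (Derives.of_mem (.inr (.inr ⟨q, rfl⟩))))
  have h4 := h3.trans (Derives.tensor (I := H × J) (fun t => B t.1) k
    (fun t c => w (t, c)) (fun t c a => .inl (hB t.1 c a)) (fun t c => .inr ⟨(t, c), rfl⟩))
  have h5 := h4.trans (U := Set.range fun q : J × (Fin k → C) => ∑ e, ∑ b : Fin k → C,
      (∏ i, B e (q.2 i) (b i)) *
        ((∑ a, (∏ i, A e (b i) (a i)) * f q.1 a) * ∑ a, (∏ i, A e (b i) (a i)) * g q.1 a))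
    (Derives.range fun q => Derives.sum (c := 0) Finset.univ fun e _ =>
      Derives.of_mem (.inr ⟨((e, q.1), q.2), rfl⟩))
  refine h5.mono subset_rfl (le_of_eq ?_)
  simp only [Fintype.card_prod, Fintype.card_pi, Finset.prod_const, Finset.card_univ,
    Fintype.card_fin]
  ring

variable {l₁ l₂ : ℕ}

theorem Derives.evalMatrix (h₁ h₂ k L₁ L₂ e : ℕ) (b a : Fin (l₁ + 1) ⊕ Fin (l₂ + 1)) :
    Derives ω inp S 1
      {fun x => SigmaRho.evalMatrix (ω x ^ h₁) (ω x ^ h₂) k L₁ L₂ e b a} := by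
  have key : ∀ h L b a : ℕ, Derives ω inp S 1 {fun x => evalEntry (ω x ^ h) k L e b a} := by
    intro h L b a
    unfold evalEntry
    split_ifs
    · simp only [← pow_mul]
      exact Derives.root (h * ((e + (k + 1) * b) * a))
    · simpa using Derives.const 0
    · simpa using Derives.const 1
  have hz : Derives ω inp S 1 {fun x => (0 : F x)} := by simpa using Derives.const 0
  rcases b with b | b <;> rcases a with a | a
  exacts [key h₁ L₁ b a, hz, hz, key h₂ L₂ b a]

theorem Derives.interpMatrix (h₁ h₂ k L₁ L₂ : ℕ) (hl₁ : L₁ = l₁ ∨ L₁ = l₁ + 1)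
    (hl₂ : L₂ = l₂ ∨ L₂ = l₂ + 1) :
    Derives ω inp S ((k + 1) * (l₁ + 1 + (l₂ + 1)) * (5 * (l₁ + 1 + (l₂ + 1)) + 8))
      (Set.range fun t : Fin (k + 1) × (Fin (l₁ + 1) ⊕ Fin (l₂ + 1)) ×
          (Fin (l₁ + 1) ⊕ Fin (l₂ + 1)) => fun x =>
        SigmaRho.interpMatrix (ω x ^ h₁) (ω x ^ h₂) k L₁ L₂ t.1 t.2.1 t.2.2) := by
  set s := l₁ + 1 + (l₂ + 1) with hs
  have hlow : ∀ h L e c b : ℕ, Derives ω inp S 1 {fun x => lowEntry (ω x ^ h) k L e c b} := by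
    intro h L e c b
    simp only [lowEntry, ← pow_mul]
    exact Derives.root (h * ((e + (k + 1) * b) * (((k + 1) * L - 1) * c)))
  have key : ∀ h L e c b : ℕ, L ≤ s → Derives ω inp S (if c < L then 1 else 2 * s + 3)
      {fun x => interpEntry (ω x ^ h) k L e c b} := by
    intro h L e c b hL
    unfold interpEntry
    by_cases hc : c < L
    · simp only [if_pos hc]
      split_ifs
      · exact hlow h L e c b
      · simpa using Derives.const 0
    · simp only [if_neg hc]
      by_cases hb : b < L
      · simp only [if_pos hb]
        refine ((Derives.const 0).sub (Derives.sum (Finset.range L)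
          fun c' _ => hlow h L e c' b)).mono subset_rfl (by simp; omega) |>.subset ?_
        rw [Set.singleton_subset_iff, Set.mem_singleton_iff]
        ext x
        simp
      · simp only [if_neg hb]
        simp only [← Int.cast_natCast (R := F _) (max L 1)]
        exact (Derives.const _).mono subset_rfl (by omega)
  -- Only the row of the last label of each type can contain sums of length `L`; all other entries
  -- cost one instruction.
  let cost : Fin (l₁ + 1) ⊕ Fin (l₂ + 1) → ℕ := fun c =>
    1 + ((if c = .inl (Fin.last l₁) then 2 * s + 4 else 0) +
      if c = .inr (Fin.last l₂) then 2 * s + 4 else 0)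
  have hcost : ∑ c, cost c = 5 * s + 8 := by
    simp only [cost, Finset.sum_add_distrib, Finset.sum_ite_eq', Finset.mem_univ, if_true]
    simp only [Finset.sum_const, Finset.card_univ, Fintype.card_sum, Fintype.card_fin]
    rw [← hs]
    simp
    ring
  have h1 : ∀ (e : Fin (k + 1)) (b c : Fin (l₁ + 1) ⊕ Fin (l₂ + 1)),
      Derives ω inp S (cost c)
        {fun x => SigmaRho.interpMatrix (ω x ^ h₁) (ω x ^ h₂) k L₁ L₂ e c b} := by
    intro e b c
    have hz : Derives ω inp S (cost c) {fun x => (0 : F x)} := by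
      simpa using (Derives.const 0).mono subset_rfl (show 1 ≤ cost c from Nat.le_add_right _ _)
    rcases c with c | c <;> rcases b with b | b
    · refine (key h₁ L₁ e c b (by omega)).mono subset_rfl ?_
      have hc := c.2
      split_ifs with h
      · exact Nat.le_add_right _ _
      · simp only [cost, Sum.inl.injEq, Fin.ext_iff, Fin.val_last]
        rw [if_pos (by omega)]
        omega
    · exact hz
    · exact hz
    · refine (key h₂ L₂ e c b (by omega)).mono subset_rfl ?_
      have hc := c.2
      split_ifs with h
      · exact Nat.le_add_right _ _
      · simp only [cost, Sum.inr.injEq, Fin.ext_iff, Fin.val_last]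
        rw [if_pos (show (c : ℕ) = l₂ by omega)]
        omega
  have h2 := Derives.iUnion fun t : Fin (k + 1) × (Fin (l₁ + 1) ⊕ Fin (l₂ + 1)) =>
    Derives.range_of_cost (h1 t.1 t.2)
  refine (h2.mono subset_rfl (le_of_eq ?_)).subset ?_
  · rw [hcost]
    simp [hs]
  · rintro _ ⟨⟨e, c, b⟩, rfl⟩
    exact Set.mem_iUnion.2 ⟨(e, b), c, rfl⟩

variable {σ ρ : Set ℕ} {k : ℕ}

/-- The order of the root of unity used to join tables on `k` vertices. -/
noncomputable def rootOrder (σ ρ : Set ℕ) (k N : ℕ) : ℕ :=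
  (k + 1) * max (numExact σ) 1 * max (numExact ρ) 1 * N

/-- The number of operations used to join tables on `k` vertices, where `s` is the number of
labels, `n` bounds the table entries, and `2 ^ q` evaluation points are used. -/
def joinCost (s k n q : ℕ) : ℕ :=
  (k + 1) * s * s + (k + 1) * s * (5 * s + 8) + 2 * s ^ k * (4 * n + 11 + 2 ^ q) +
  (3 * (k * ((k + 1) * 2 ^ q * s ^ k * (2 * s + 1))) + 2 * ((k + 1) * 2 ^ q * s ^ k) +
    2 ^ q * s ^ k) + q * (s ^ k * 2 ^ q * 3) + s ^ k * (4 * n + 3)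

/-- The order of `ω` is chosen so that suitable powers of it have order `N` (for the values) and
orders `(k + 1) * max L₁ 1` and `(k + 1) * max L₂ 1` (for the two label types). The sum over the
deformations precedes the Fourier transform, which therefore handles only s^k sequences. -/
theorem derives_joinTable {inp : ∀ x : E, Colouring σ ρ k ⊕ Colouring σ ρ k → F x} (o : Objective)
    (n q : ℕ) (hq : 2 * n < 2 ^ q) (Al Ar : E → Table σ ρ k)
    (hAl : ∀ x c, ∀ a ∈ Al x c, a ≤ n) (hAr : ∀ x c, ∀ a ∈ Ar x c, a ≤ n)
    (hl : ∀ x c, inp x (.inl c) = embed (F x) (Al x c))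
    (hr : ∀ x c, inp x (.inr c) = embed (F x) (Ar x c))
    (hω : ∀ x, IsPrimitiveRoot (ω x) (rootOrder σ ρ k (2 ^ q)))
    (hn : ∀ x, ∀ m : ℕ, 0 < m → m ≤ n + 1 → (m : F x) ≠ 0)
    (hs : ∀ x, ∀ m : ℕ, 0 < m → m ≤ numLabels σ ρ ^ (2 * k) → (m : F x) ≠ 0) :
    Derives ω inp ∅ (joinCost (numLabels σ ρ) k n q)
      (Set.range fun c x => embed (F x) (SigmaRho.joinTable o (Al x) (Ar x) c)) := by
  have hσ := numExact_eq σ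
  have hρ := numExact_eq ρ
  have hcard : numLabels σ ρ = lastLabel σ + 1 + (lastLabel ρ + 1) := by simp [numLabels]
  have hcard' : Fintype.card (Label σ ρ) = numLabels σ ρ := rfl
  unfold rootOrder at hω
  set L₁ := numExact σ
  set L₂ := numExact ρ
  set N := 2 ^ q with hN
  have hNpos : 0 < N := by positivity
  set r := (k + 1) * max L₁ 1 * max L₂ 1 with hr'
  -- Raising these two roots to the powers `max L₁ 1` and `max L₂ 1` gives the same element, the
  -- common `ε`.
  set A : Fin (k + 1) → Label σ ρ → Label σ ρ → ∀ x, F x := fun e b a x =>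
    evalMatrix (ω x ^ (max L₂ 1 * N)) (ω x ^ (max L₁ 1 * N)) k L₁ L₂ e b a with hAdef
  set B : Fin (k + 1) → Label σ ρ → Label σ ρ → ∀ x, F x := fun e c b x =>
    interpMatrix (ω x ^ (max L₂ 1 * N)) (ω x ^ (max L₁ 1 * N)) k L₁ L₂ e c b with hBdef
  set tab : Colouring σ ρ k ⊕ Colouring σ ρ k → E → Option ℕ := fun i x =>
    i.elim (Al x) (Ar x) with htab
  set y : Colouring σ ρ k ⊕ Colouring σ ρ k → ℕ → ∀ x, F x := fun i j x =>
    monomialValue (ω x ^ (r * (N - 1))) (tab i x) j with hy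
  have dA := Derives.range (ω := ω) (inp := inp) (S := ∅)
    (f := fun t : Fin (k + 1) × Label σ ρ × Label σ ρ => A t.1 t.2.1 t.2.2)
    fun t => Derives.evalMatrix _ _ _ _ _ _ _ _
  have dB := Derives.interpMatrix (ω := ω) (inp := inp) (S := ∅) (max L₂ 1 * N) (max L₁ 1 * N) k
    L₁ L₂ hσ hρ
  have dI := Derives.range (ω := ω) (inp := inp) (S := ∅) fun i => Derives.input i
  have dY : Derives ω inp ∅ (2 * numLabels σ ρ ^ k * (4 * n + 11 + N))
      (⋃ i, Set.range fun j : Fin N => y i j) := by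
    refine (dI.trans (Derives.iUnion fun i => Derives.monomialValue n N (r * (N - 1)) _ (tab i)
      (.inr ⟨i, rfl⟩) ?_ ?_ hn)).mono subset_rfl (le_of_eq ?_)
    · rintro x
      rcases i with c | c
      exacts [hl x c, hr x c]
    · rcases i with c | c
      exacts [fun x => hAl x c, fun x => hAr x c]
    · simp only [Fintype.card_sum, Fintype.card_pi, Finset.prod_const, Finset.card_univ,
        Fintype.card_fin, hcard]
      ring
  have d0 := (dA.union dB).union dY
  have d1 := d0.trans (Derives.bilinear A B k (fun (j : Fin N) c => y (.inl c) j)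
    (fun j c => y (.inr c) j) (fun e b a => .inr (.inl (.inl ⟨(e, b, a), rfl⟩)))
    (fun e b a => .inr (.inl (.inr ⟨(e, b, a), rfl⟩)))
    (fun j c => .inr (.inr (Set.mem_iUnion.2 ⟨.inl c, j, rfl⟩)))
    (fun j c => .inr (.inr (Set.mem_iUnion.2 ⟨.inr c, j, rfl⟩))))
  set Z : Colouring σ ρ k → ℕ → ∀ x, F x := fun c j => ∑ e, ∑ b : Colouring σ ρ k,
    (∏ i, B e (c i) (b i)) * ((∑ a, (∏ i, A e (b i) (a i)) * y (.inl a) j) *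
      ∑ a, (∏ i, A e (b i) (a i)) * y (.inr a) j) with hZ
  have d2 := d1.trans (Derives.fft q r
    (by ext x; simpa using (hω x).pow_eq_one) Z fun c j hj => .inr ⟨(⟨j, hj⟩, c), rfl⟩)
  set f : Colouring σ ρ k → ℕ → ∀ x, F x := fun c m =>
    ∑ j ∈ Finset.range N, ω ^ (r * (j * m)) * Z c j with hf
  have hfx : ∀ c m x, m ≤ 2 * n → f c m x =
      ((k + 1) * ∏ i, (labelScale L₁ L₂ (c i) : F x)) *
        (N * (joinPairs (Al x) (Ar x) c m).card) := by
    intro c m x hm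
    have hθ : IsPrimitiveRoot (ω x ^ r) N := (hω x).pow (by positivity) rfl
    have hη₁ : IsPrimitiveRoot (ω x ^ (max L₂ 1 * N)) ((k + 1) * max L₁ 1) :=
      (hω x).pow (by positivity) (by rw [hr']; ring)
    have hη₂ : IsPrimitiveRoot (ω x ^ (max L₁ 1 * N)) ((k + 1) * max L₂ 1) :=
      (hω x).pow (by positivity) (by rw [hr']; ring)
    rw [← sum_joinTensor hθ (hAl x) (hAr x) hq c hm, Finset.mul_sum]
    simp only [hf, Finset.sum_apply, Pi.mul_apply, Pi.pow_apply]
    refine Finset.sum_congr rfl fun j _ => ?_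
    rw [pow_mul, mul_left_comm, ← sum_sum_prod_interpMatrix hσ hρ hη₁ hη₂
      rfl (by rw [← pow_mul]; ring_nf), ← Fin.sum_univ_eq_sum_range]
    simp [hZ, hAdef, hBdef, hy, htab, Finset.sum_apply, Finset.prod_apply, pow_mul]
  have hne : ∀ c m x, m ≤ 2 * n → (f c m x ≠ 0 ↔ m ∈ joinValues (Al x) (Ar x) c) := by
    intro c m x hm
    rw [hfx c m x hm, ← joinPairs_nonempty]
    have : NeZero (r * N) := ⟨by positivity⟩
    -- A field with a primitive root of order `r * N` has characteristic prime to `r * N`; every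
    -- scale factor divides this number.
    have h1 : ((r * N : ℕ) : F x) ≠ 0 := (hω x).neZero'.out
    rw [hr'] at h1
    push_cast at h1
    have h2 : (∏ i, (labelScale L₁ L₂ (c i) : F x)) ≠ 0 := by
      refine Finset.prod_ne_zero_iff.2 fun i _ => ?_
      rcases c i with a | a
      · exact fun h => h1 (by simp only [labelScale] at h; rw [h]; ring)
      · exact fun h => h1 (by simp only [labelScale] at h; rw [h]; ring)
    have h3 : ((k : F x) + 1) ≠ 0 := fun h => h1 (by rw [h]; ring)
    have h4 : (N : F x) ≠ 0 := fun h => h1 (by rw [h]; ring)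
    rw [← Finset.card_pos]
    constructor
    · intro h
      refine Nat.pos_of_ne_zero fun h5 => h ?_
      rw [h5]
      simp
    · intro h
      exact mul_ne_zero (mul_ne_zero h3 h2)
        (mul_ne_zero h4 (hs x _ h (card_joinPairs_le _ _ _ _)))
  have hle : ∀ c x, ∀ m ∈ joinValues (Al x) (Ar x) c, m < 2 * n + 1 := by
    rintro c x _ ⟨cl, cr, a, b, -, ha, hb, rfl⟩
    have := hAl x cl a ha
    have := hAr x cr b hb
    omega
  have d3 := d2.trans (Derives.range fun c => Derives.optimum o (2 * n + 1) (f c)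
    (fun x => joinValues (Al x) (Ar x) c) (hle c)
    (fun m hm => .inr ⟨(c, ⟨m, by omega⟩), rfl⟩) fun x m hm => hne c m x (by omega))
  refine d3.mono subset_rfl (le_of_eq ?_)
  simp only [Fintype.card_prod, Fintype.card_pi, Finset.prod_const, Finset.card_univ,
    Fintype.card_fin, hcard', ← hcard, joinCost]
  ring

end JoinProgram

/-! ### The memoisation table of a join node -/

section Labels

variable {τ : Set ℕ}

theorem HasLabel.add {a b c : Fin (lastLabel τ + 1)} {m m' : ℕ} (ha : HasLabel τ a m)
    (hb : HasLabel τ b m') (hc : HasLabel τ c (a + b)) : HasLabel τ c (m + m') := by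
  have := a.2
  have := b.2
  have := c.2
  unfold HasLabel at *
  by_cases h : τ.Finite
  · simp only [h, not_true_eq_false, false_and, or_false] at *
    omega
  · simp only [h, not_false_eq_true, true_and] at *
    omega

theorem HasLabel.exists_add {c : Fin (lastLabel τ + 1)} {m m' : ℕ} (hc : HasLabel τ c (m + m')) :
    ∃ a b : Fin (lastLabel τ + 1), HasLabel τ a m ∧ HasLabel τ b m' ∧ HasLabel τ c (a + b) := by
  -- Truncate both numbers at ℓ. For finite τ nothing is cut off, since `m + m' = c ≤ ℓ`.
  refine ⟨⟨min m (lastLabel τ), by omega⟩, ⟨min m' (lastLabel τ), by omega⟩, ?_⟩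
  have := c.2
  unfold HasLabel at *
  dsimp only
  by_cases h : τ.Finite
  · simp only [h, not_true_eq_false, false_and, or_false] at *
    omega
  · simp only [h, not_false_eq_true, true_and] at *
    omega

theorem optimum_mem {o : Objective} {S : Set ℕ} (hS : BddAbove S) {m : ℕ}
    (h : optimum o S = some m) : m ∈ S := by
  unfold optimum at h
  split_ifs at h with hne
  cases o with
  | minimise => exact Option.some.inj h ▸ Nat.sInf_mem hne
  | maximise => exact Option.some.inj h ▸ Nat.sSup_mem hne hS

/-- `m` is at least as good as `m'`. -/
def Objective.Better : Objective → ℕ → ℕ → Prop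
  | .minimise, m, m' => m ≤ m'
  | .maximise, m, m' => m' ≤ m

theorem Objective.Better.add {o : Objective} {a a' b b' : ℕ} (h : o.Better a a')
    (h' : o.Better b b') : o.Better (a + b) (a' + b') := by
  cases o with
  | minimise => exact Nat.add_le_add h h'
  | maximise => exact Nat.add_le_add h h'

theorem exists_optimum (o : Objective) {S : Set ℕ} (hS : BddAbove S) {m : ℕ} (hm : m ∈ S) :
    ∃ m', optimum o S = some m' ∧ o.Better m' m := by
  have hne : S.Nonempty := ⟨m, hm⟩
  unfold optimum
  rw [if_pos hne]
  cases o with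
  | minimise => exact ⟨_, rfl, Nat.sInf_le hm⟩
  | maximise => exact ⟨_, rfl, le_csSup hS hm⟩

/-- At a join node `S` holds all attained sizes and `J` only the sums of optimal entries of the
children. The comparisons between `m₁`, `m₂`, `m₃` and `m₄ = m₁` close a cycle, which forces
equality. -/
theorem optimum_eq_of_subset (o : Objective) {S J : Set ℕ} (hS : BddAbove S) (hJ : J ⊆ S)
    (h : ∀ m ∈ S, ∃ m' ∈ J, o.Better m' m) : optimum o S = optimum o J := by
  rcases S.eq_empty_or_nonempty with rfl | ⟨m, hm⟩
  · rw [Set.subset_empty_iff.1 hJ]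
  obtain ⟨m₁, h₁, -⟩ := exists_optimum o hS hm
  have h₁S := optimum_mem hS h₁
  obtain ⟨m₂, h₂, h₂₁⟩ := h m₁ h₁S
  obtain ⟨m₃, h₃, h₃₂⟩ := exists_optimum o (hS.mono hJ) h₂
  obtain ⟨m₄, h₄, h₄₃⟩ := exists_optimum o hS (hJ (optimum_mem (hS.mono hJ) h₃))
  obtain rfl : m₁ = m₄ := Option.some.inj (h₁.symm.trans h₄)
  rw [h₁, h₃]
  cases o with
  | minimise => exact congrArg some (le_antisymm h₄₃ (h₃₂.trans h₂₁))
  | maximise => exact congrArg some (le_antisymm (h₂₁.trans h₃₂) h₄₃)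

end Labels

/-! ### Subtrees of a rooted tree decomposition -/

namespace RootedTreeDecomposition

variable {V : Type*} {G : SimpleGraph V} {T : Type*} (t : RootedTreeDecomposition G T)

/-- The nodes on the path from the root to `j`. -/
noncomputable def rootPath (j : T) : List T :=
  (t.isTree.existsUnique_path t.root j).choose.support

variable {t}

theorem support_eq_rootPath {j : T} {w : t.tree.Walk t.root j} (hw : w.IsPath) :
    w.support = t.rootPath j := by
  rw [rootPath, (t.isTree.existsUnique_path t.root j).choose_spec.2 w hw]

theorem exists_rootPath (t : RootedTreeDecomposition G T) (j : T) :
    ∃ w : t.tree.Walk t.root j, w.IsPath ∧ w.support = t.rootPath j :=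
  have ⟨w, hw, _⟩ := t.isTree.existsUnique_path t.root j
  ⟨w, hw, support_eq_rootPath hw⟩

theorem below_iff {i j : T} : t.Below i j ↔ i ∈ t.rootPath j := by
  obtain ⟨w, hw, hs⟩ := t.exists_rootPath j
  exact ⟨fun h => hs ▸ h w hw, fun h w' hw' => support_eq_rootPath hw' ▸ h⟩

theorem rootPath_getLast? (j : T) : (t.rootPath j).getLast? = some j := by
  obtain ⟨w, hw, hs⟩ := t.exists_rootPath j
  rw [← hs, List.getLast?_eq_some_getLast (by simp), SimpleGraph.Walk.getLast_support]

theorem rootPath_injective {i j : T} (h : t.rootPath i = t.rootPath j) : i = j :=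
  Option.some.inj (rootPath_getLast? (t := t) i ▸ rootPath_getLast? (t := t) j ▸ congrArg _ h)

theorem below_refl (j : T) : t.Below j j := fun w _ => w.end_mem_support

theorem rootPath_prefix {i j : T} (h : t.Below i j) : t.rootPath i <+: t.rootPath j := by
  classical
  obtain ⟨w, hw, hs⟩ := t.exists_rootPath j
  have hi := h w hw
  rw [← support_eq_rootPath (hw.takeUntil hi), ← hs]
  exact w.support_takeUntil_prefix_support hi

theorem rootPath_of_adj {a b : T} (h : t.tree.Adj a b) :
    (t.rootPath b = t.rootPath a ++ [b] ∧ b ∉ t.rootPath a) ∨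
      (t.rootPath a = t.rootPath b ++ [a] ∧ a ∉ t.rootPath b) := by
  classical
  have key : ∀ {a b : T}, t.tree.Adj a b → b ∉ t.rootPath a →
      t.rootPath b = t.rootPath a ++ [b] := by
    intro a b h hb
    obtain ⟨w, hw, hs⟩ := t.exists_rootPath a
    rw [← support_eq_rootPath (hw.concat (hs ▸ hb) h), SimpleGraph.Walk.support_concat, hs]
  by_cases hb : b ∈ t.rootPath a
  · right
    have ha : a ∉ t.rootPath b := by
      obtain ⟨w, hw, hs⟩ := t.exists_rootPath a
      rw [← hs] at hb
      rw [← support_eq_rootPath (hw.takeUntil hb)]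
      exact SimpleGraph.Walk.endpoint_notMem_support_takeUntil hw hb h.ne
    exact ⟨key h.symm ha, ha⟩
  · exact .inl ⟨key h hb, hb⟩

theorem IsChild.rootPath {i c : T} (h : t.IsChild i c) :
    t.rootPath c = t.rootPath i ++ [c] := by
  rcases rootPath_of_adj h.1 with h1 | h1
  · exact h1.1
  · exact absurd (below_iff.1 h.2) h1.2

/-- Root paths of adjacent nodes differ by one final node, so the claim spreads along walks starting
from the root, where it is trivial. -/
theorem below_iff_child {i j : T} : t.Below i j ↔ j = i ∨ ∃ c, t.IsChild i c ∧ t.Below c j := by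
  constructor
  · have key : ∀ {u v : T} (_ : t.tree.Walk u v),
        (t.Below i v → v = i ∨ ∃ c, t.IsChild i c ∧ t.Below c v) →
        (t.Below i u → u = i ∨ ∃ c, t.IsChild i c ∧ t.Below c u) := by
      intro u v w
      induction w with
      | nil => exact id
      | @cons b a v h w ih =>
        intro hv hi
        replace ih := ih hv
        simp only [below_iff] at *
        rcases rootPath_of_adj h with ⟨h1, h2⟩ | ⟨h1, h2⟩
        · rcases ih (by rw [h1]; exact List.mem_append_left _ hi) with rfl | ⟨c, hc, hca⟩
          · exact absurd hi h2
          · rw [h1, List.mem_append, List.mem_singleton] at hca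
            rcases hca with hca | rfl
            · exact .inr ⟨c, hc, hca⟩
            · exact .inl (rootPath_injective
                (List.append_cancel_right (h1.symm.trans hc.rootPath)))
        · rw [h1, List.mem_append, List.mem_singleton] at hi
          rcases hi with hi | rfl
          · rw [h1]
            rcases ih hi with rfl | ⟨c, hc, hca⟩
            · exact .inr ⟨b, ⟨h.symm, below_iff.2 (by simp [h1, hi])⟩, by simp⟩
            · exact .inr ⟨c, hc, List.mem_append_left _ hca⟩
          · exact .inl rfl
    obtain ⟨w⟩ := t.isTree.connected.preconnected j t.root
    refine key w fun h => .inl ?_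
    have h1 := h .nil .nil
    rw [SimpleGraph.Walk.support_nil, List.mem_singleton] at h1
    exact h1.symm
  · rintro (rfl | ⟨c, hc, hcj⟩)
    · exact below_refl _
    · exact below_iff.2 ((rootPath_prefix hcj).subset (below_iff.1 hc.2))

/-- The only edge that leaves the subtree of `l` leads to `i`. -/
theorem IsChild.below_of_walk {i l : T} (h : t.IsChild i l) {a b : T} (w : t.tree.Walk a b)
    (hi : i ∉ w.support) (ha : t.Below l a) : t.Below l b := by
  induction w with
  | nil => exact ha
  | @cons a b v hab w ih =>
    rw [SimpleGraph.Walk.support_cons, List.mem_cons, not_or] at hi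
    refine ih hi.2 ?_
    simp only [below_iff] at *
    rcases rootPath_of_adj hab with ⟨h1, -⟩ | ⟨h1, -⟩
    · rw [h1]
      exact List.mem_append_left _ ha
    · rw [h1, List.mem_append, List.mem_singleton] at ha
      rcases ha with ha | rfl
      · exact ha
      · exact absurd (rootPath_injective (List.append_cancel_right (h1.symm.trans h.rootPath)))
          fun h2 => hi.2 (h2 ▸ w.start_mem_support)

/-- The root paths of `l` and `r` are prefixes of equal length of the root path of `j`. -/
theorem IsChild.eq_of_below {i l r j : T} (hl : t.IsChild i l) (hr : t.IsChild i r)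
    (hlj : t.Below l j) (hrj : t.Below r j) : l = r := by
  have h1 := rootPath_prefix hlj
  have h2 := rootPath_prefix hrj
  refine rootPath_injective ((List.prefix_of_prefix_length_le h1 h2 ?_).eq_of_length ?_) <;>
    simp [hl.rootPath, hr.rootPath]

/-- A vertex that lies below the child `l` of `i` but not in the bag of `i` lies only in bags
below `l`. -/
theorem IsChild.below_of_mem_bag {i l j : T} (h : t.IsChild i l) {v : V} (hv : v ∈ t.verts l)
    (hvi : v ∉ t.bag i) (hj : v ∈ t.bag j) : t.Below l j := by
  obtain ⟨j', hj', hvj'⟩ := hv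
  obtain ⟨w, hw, -⟩ := t.isTree.existsUnique_path j' j
  exact h.below_of_walk w (fun hi => hvi (t.connected v j' j i w hw hi hvj' hj)) hj'

theorem mem_verts_of_adj {i l : T} (h : t.IsChild i l) {u v : V} (hu : u ∈ t.verts l)
    (hui : u ∉ t.bag i) (huv : G.Adj u v) : v ∈ t.verts l := by
  obtain ⟨j, hj, hj'⟩ := t.exists_edge_bag u v huv
  exact ⟨j, h.below_of_mem_bag hu hui hj, hj'⟩

/-! ### Splitting partial solutions at a join node -/

namespace IsJoinNode

variable {i l r : T} (h : t.IsJoinNode i l r)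
include h

theorem symm : t.IsJoinNode i r l :=
  ⟨h.1.symm, fun j => (h.2.1 j).trans or_comm, h.2.2.2, h.2.2.1⟩

theorem isChild_left : t.IsChild i l := (h.2.1 l).2 (.inl rfl)

theorem isChild_right : t.IsChild i r := (h.2.1 r).2 (.inr rfl)

theorem bag_subset_left : t.bag i ⊆ t.verts l := fun _ hv => ⟨l, below_refl l, h.2.2.1.symm ▸ hv⟩

theorem verts_eq : t.verts i = t.verts l ∪ t.verts r := by
  ext v
  constructor
  · rintro ⟨j, hj, hv⟩
    rcases below_iff_child.1 hj with rfl | ⟨c, hc, hcj⟩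
    · exact .inl (h.bag_subset_left hv)
    · rcases (h.2.1 c).1 hc with rfl | rfl
      · exact .inl ⟨j, hcj, hv⟩
      · exact .inr ⟨j, hcj, hv⟩
  · rintro (⟨j, hj, hv⟩ | ⟨j, hj, hv⟩)
    · exact ⟨j, below_iff_child.2 (.inr ⟨l, h.isChild_left, hj⟩), hv⟩
    · exact ⟨j, below_iff_child.2 (.inr ⟨r, h.isChild_right, hj⟩), hv⟩

/-- A vertex outside the bag has all its bags below a single child, and the subtrees of the two
children are disjoint. -/
theorem mem_bag {v : V} (hl : v ∈ t.verts l) (hr : v ∈ t.verts r) : v ∈ t.bag i := by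
  by_contra hv
  obtain ⟨j, hj, hvj⟩ := hr
  exact h.1 (h.isChild_left.eq_of_below h.isChild_right
    (h.isChild_left.below_of_mem_bag hl hv hvj) hj)

theorem mem_verts_left {u v : V} (huv : (t.nodeGraph l).Adj u v) : u ∈ t.verts l := by
  rcases huv.2 with hu | hv
  · exact hu.1
  · exact mem_verts_of_adj h.isChild_left hv.1 (h.2.2.1 ▸ hv.2) huv.1.symm

theorem nodeGraph_adj {u v : V} :
    (t.nodeGraph i).Adj u v ↔ (t.nodeGraph l).Adj u v ∨ (t.nodeGraph r).Adj u v := by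
  simp only [nodeGraph, h.2.2.1, h.2.2.2, h.verts_eq, Set.mem_sdiff, Set.mem_union]
  tauto

/-- A common edge would have both ends in V_l ∩ V_r ⊆ X_i, but edges inside the bag are excluded
from E_l. Thus no neighbour is counted twice. -/
theorem not_adj_right {u v : V} (hl : (t.nodeGraph l).Adj u v) : ¬ (t.nodeGraph r).Adj u v := by
  intro hr
  have hu := h.mem_bag (h.mem_verts_left hl) (h.symm.mem_verts_left hr)
  have hv := h.mem_bag (h.mem_verts_left hl.symm) (h.symm.mem_verts_left hr.symm)
  rcases hl.2 with h1 | h1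
  · exact h1.2 (h.2.2.1.symm ▸ hu)
  · exact h1.2 (h.2.2.1.symm ▸ hv)

theorem degIn_eq_zero (D : Set V) {v : V} (hv : v ∉ t.verts l) : t.degIn l D v = 0 := by
  rw [degIn, show {u | u ∈ D ∧ (t.nodeGraph l).Adj v u} = ∅ from ?_, Set.ncard_empty]
  exact Set.eq_empty_of_forall_notMem fun u hu => hv (h.mem_verts_left hu.2)

theorem degIn_eq [Finite V] {D Dl Dr : Set V} (hl : D ∩ t.verts l = Dl)
    (hr : D ∩ t.verts r = Dr) (v : V) :
    t.degIn i D v = t.degIn l Dl v + t.degIn r Dr v := by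
  rw [degIn, degIn, degIn, ← Set.ncard_union_eq]
  · congr 1
    ext u
    simp only [Set.mem_ofPred_eq, Set.mem_union, h.nodeGraph_adj, ← hl, ← hr, Set.mem_inter_iff]
    have h1 : (t.nodeGraph l).Adj v u → u ∈ t.verts l := fun h1 => h.mem_verts_left h1.symm
    have h2 : (t.nodeGraph r).Adj v u → u ∈ t.verts r := fun h1 => h.symm.mem_verts_left h1.symm
    tauto
  · exact Set.disjoint_left.2 fun u hu hu' => h.not_adj_right hu.2 hu'.2

theorem isPartialSolution_left [Finite V] {σ ρ : Set ℕ} {D : Set V}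
    (hD : t.IsPartialSolution σ ρ i D) : t.IsPartialSolution σ ρ l (D ∩ t.verts l) := by
  refine ⟨Set.inter_subset_right, fun v hv => ?_⟩
  have hvi : v ∉ t.bag i := h.2.2.1 ▸ hv.2
  have h1 := hD.2 v ⟨h.verts_eq ▸ .inl hv.1, hvi⟩
  rw [h.degIn_eq rfl rfl, h.symm.degIn_eq_zero _ fun hr => hvi (h.mem_bag hv.1 hr),
    add_zero] at h1
  exact ⟨fun h2 => h1.1 h2.1, fun h2 => h1.2 fun h3 => h2 ⟨h3, hv.1⟩⟩

theorem ncard_eq [Finite V] {D Dl Dr : Set V} (hD : D ⊆ t.verts i) (hl : D ∩ t.verts l = Dl)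
    (hr : D ∩ t.verts r = Dr) :
    (D \ t.bag i).ncard = (Dl \ t.bag l).ncard + (Dr \ t.bag r).ncard := by
  rw [← Set.ncard_union_eq, h.2.2.1, h.2.2.2, ← hl, ← hr, ← Set.union_sdiff_distrib,
    ← Set.inter_union_distrib_left, ← h.verts_eq, Set.inter_eq_left.2 hD]
  refine Set.disjoint_left.2 fun v hv hv' => hv.2 ?_
  rw [h.2.2.1]
  exact h.mem_bag (hl.symm ▸ hv.1 : v ∈ D ∩ t.verts l).2 (hr.symm ▸ hv'.1 : v ∈ D ∩ t.verts r).2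

theorem exists_vertexHasLabel [Finite V] {σ ρ : Set ℕ} {D : Set V} {v : V} (hv : v ∈ t.bag i)
    {c : Label σ ρ} (hc : t.VertexHasLabel i D v c) :
    ∃ a b : Label σ ρ, LabelJoin a b c ∧ t.VertexHasLabel l (D ∩ t.verts l) v a ∧
      t.VertexHasLabel r (D ∩ t.verts r) v b := by
  have hvl := h.bag_subset_left hv
  have hvr := h.symm.bag_subset_left hv
  have hdeg := h.degIn_eq (D := D) rfl rfl v
  rcases c with c | c
  · obtain ⟨h1, h2⟩ := hc
    rw [hdeg] at h2
    obtain ⟨a, b, ha, hb, hab⟩ := h2.exists_add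
    exact ⟨.inl a, .inl b, hab, ⟨⟨h1, hvl⟩, ha⟩, ⟨⟨h1, hvr⟩, hb⟩⟩
  · obtain ⟨h1, h2⟩ := hc
    rw [hdeg] at h2
    obtain ⟨a, b, ha, hb, hab⟩ := h2.exists_add
    exact ⟨.inr a, .inr b, hab, ⟨fun h3 => h1 h3.1, ha⟩, ⟨fun h3 => h1 h3.1, hb⟩⟩

end IsJoinNode

/-- The sizes outside the bag of the partial solutions described by a colouring. -/
def solutionSizes (t : RootedTreeDecomposition G T) {σ ρ : Set ℕ} (i : T) {k : ℕ} (x : Fin k → V)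
    (c : Colouring σ ρ k) : Set ℕ :=
  {m | ∃ D : Set V, t.IsPartialSolution σ ρ i D ∧
    (∀ j, t.VertexHasLabel i D (x j) (c j)) ∧ m = (D \ t.bag i).ncard}

theorem le_card_of_mem_solutionSizes [Fintype V] {σ ρ : Set ℕ} {i : T} {k : ℕ} {x : Fin k → V}
    {c : Colouring σ ρ k} {m : ℕ} (hm : m ∈ t.solutionSizes i x c) : m ≤ Fintype.card V := by
  obtain ⟨D, -, -, rfl⟩ := hm
  rw [← Nat.card_eq_fintype_card, ← Set.ncard_univ]
  exact Set.ncard_le_ncard (Set.subset_univ _)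

theorem bddAbove_solutionSizes [Fintype V] {σ ρ : Set ℕ} (i : T) {k : ℕ} (x : Fin k → V)
    (c : Colouring σ ρ k) : BddAbove (t.solutionSizes i x c) :=
  ⟨Fintype.card V, fun _ => le_card_of_mem_solutionSizes⟩

theorem memoTable_le_card [Fintype V] (σ ρ : Set ℕ) (o : Objective) (i : T) {k : ℕ}
    (x : Fin k → V) (c : Colouring σ ρ k) : ∀ m ∈ t.memoTable σ ρ o i x c, m ≤ Fintype.card V :=
  fun _ hm => le_card_of_mem_solutionSizes (optimum_mem (bddAbove_solutionSizes i x c) hm)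

theorem IsJoinNode.mem_solutionSizes [Finite V] {i l r : T} (h : t.IsJoinNode i l r) {σ ρ : Set ℕ}
    {k : ℕ} {x : Fin k → V} (hx : Set.range x = t.bag i) {c : Colouring σ ρ k} {m : ℕ} :
    m ∈ t.solutionSizes i x c ↔ ∃ (cl cr : Colouring σ ρ k) (a b : ℕ),
      (∀ j, LabelJoin (cl j) (cr j) (c j)) ∧ a ∈ t.solutionSizes l x cl ∧
        b ∈ t.solutionSizes r x cr ∧ m = a + b := by
  have hxi : ∀ j, x j ∈ t.bag i := fun j => hx ▸ Set.mem_range_self j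
  constructor
  · rintro ⟨D, hD, hc, rfl⟩
    choose cl cr hj hcl hcr using fun j => h.exists_vertexHasLabel (hxi j) (hc j)
    exact ⟨cl, cr, _, _, hj, ⟨_, h.isPartialSolution_left hD, hcl, rfl⟩,
      ⟨_, h.symm.isPartialSolution_left hD, hcr, rfl⟩, h.ncard_eq hD.1 rfl rfl⟩
  · rintro ⟨cl, cr, _, _, hj, ⟨Dl, hDl, hcl, rfl⟩, ⟨Dr, hDr, hcr, rfl⟩, rfl⟩
    -- Labels can be joined only within one type, and the type records membership in the solution;
    -- hence `Dl` and `Dr` agree on the bag, and their union restricts back to each of them.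
    have hmem : ∀ v ∈ t.bag i, v ∈ Dl ↔ v ∈ Dr := by
      rw [← hx]
      rintro _ ⟨j, rfl⟩
      have h1 := hj j
      have h2 := hcl j
      have h3 := hcr j
      generalize cl j = a at h1 h2
      generalize cr j = b at h1 h3
      rcases a with a | a <;> rcases b with b | b
      · exact ⟨fun _ => h3.1, fun _ => h2.1⟩
      · exact h1.elim
      · exact h1.elim
      · exact ⟨fun h4 => absurd h4 h2.1, fun h4 => absurd h4 h3.1⟩
    have hl : (Dl ∪ Dr) ∩ t.verts l = Dl := by
      ext v
      constructor
      · rintro ⟨h1 | h1, h2⟩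
        · exact h1
        · exact (hmem v (h.mem_bag h2 (hDr.1 h1))).2 h1
      · exact fun h1 => ⟨.inl h1, hDl.1 h1⟩
    have hr : (Dl ∪ Dr) ∩ t.verts r = Dr := by
      ext v
      constructor
      · rintro ⟨h1 | h1, h2⟩
        · exact (hmem v (h.mem_bag (hDl.1 h1) h2)).1 h1
        · exact h1
      · exact fun h1 => ⟨.inr h1, hDr.1 h1⟩
    have hsub : Dl ∪ Dr ⊆ t.verts i := h.verts_eq ▸ Set.union_subset_union hDl.1 hDr.1
    refine ⟨Dl ∪ Dr, ⟨hsub, fun v hv => ?_⟩, fun j => ?_, (h.ncard_eq hsub hl hr).symm⟩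
    · rw [h.degIn_eq hl hr]
      have hv' := hv.1
      rw [h.verts_eq] at hv'
      rcases hv' with h1 | h1
      · have h2 : v ∉ t.verts r := fun h2 => hv.2 (h.mem_bag h1 h2)
        rw [h.symm.degIn_eq_zero _ h2, add_zero]
        have h3 := hDl.2 v ⟨h1, h.2.2.1 ▸ hv.2⟩
        exact ⟨fun h4 => h3.1 (h4.resolve_right fun h5 => h2 (hDr.1 h5)),
          fun h4 => h3.2 fun h5 => h4 (.inl h5)⟩
      · have h2 : v ∉ t.verts l := fun h2 => hv.2 (h.mem_bag h2 h1)
        rw [h.degIn_eq_zero _ h2, zero_add]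
        have h3 := hDr.2 v ⟨h1, h.2.2.2 ▸ hv.2⟩
        exact ⟨fun h4 => h3.1 (h4.resolve_left fun h5 => h2 (hDl.1 h5)),
          fun h4 => h3.2 fun h5 => h4 (.inr h5)⟩
    · have h1 := hj j
      have h2 := hcl j
      have h3 := hcr j
      have hdeg := h.degIn_eq hl hr (x j)
      generalize cl j = a at h1 h2
      generalize cr j = b at h1 h3
      generalize c j = d at h1 ⊢
      rcases a with a | a <;> rcases b with b | b <;> rcases d with d | d <;> try exact h1.elim
      · exact ⟨.inl h2.1, hdeg ▸ h2.2.add h3.2 h1⟩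
      · exact ⟨fun h4 => h4.elim h2.1 h3.1, hdeg ▸ h2.2.add h3.2 h1⟩

/-- The memoisation table of a join node is the join of the tables of its children. -/
theorem IsJoinNode.memoTable_eq [Fintype V] {i l r : T} (h : t.IsJoinNode i l r) (σ ρ : Set ℕ)
    (o : Objective) {k : ℕ} {x : Fin k → V} (hx : Set.range x = t.bag i) :
    t.memoTable σ ρ o i x = joinTable o (t.memoTable σ ρ o l x) (t.memoTable σ ρ o r x) := by
  ext1 c
  refine optimum_eq_of_subset o (bddAbove_solutionSizes i x c) ?_ ?_
  · rintro _ ⟨cl, cr, a, b, hj, ha, hb, rfl⟩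
    exact (h.mem_solutionSizes hx).2 ⟨cl, cr, a, b, hj,
      optimum_mem (bddAbove_solutionSizes l x cl) ha,
      optimum_mem (bddAbove_solutionSizes r x cr) hb, rfl⟩
  · intro m hm
    obtain ⟨cl, cr, a, b, hj, ha, hb, rfl⟩ := (h.mem_solutionSizes hx).1 hm
    obtain ⟨a', ha', haa'⟩ := exists_optimum o (bddAbove_solutionSizes l x cl) ha
    obtain ⟨b', hb', hbb'⟩ := exists_optimum o (bddAbove_solutionSizes r x cr) hb
    exact ⟨a' + b', ⟨cl, cr, a', b', hj, ha', hb', rfl⟩, haa'.add hbb'⟩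

end RootedTreeDecomposition

/-! ### The number of operations -/

section Cost

theorem joinCost_le {s k n q : ℕ} (hs : 2 ≤ s) (hk : 1 ≤ k) (hn : 1 ≤ n) (hq : 2 ^ q ≤ 6 * n) :
    joinCost s k n q ≤ s ^ (k + 1) * k * n * (207 * k + 18 * q) := by
  unfold joinCost
  have hP : s * s ≤ s ^ (k + 1) := by
    rw [← pow_two]
    exact Nat.pow_le_pow_right (by omega) (by omega)
  have hS : s ^ k ≤ s ^ (k + 1) := Nat.pow_le_pow_right (by omega) (by omega)
  have hPS : s ^ (k + 1) = s ^ k * s := pow_succ s k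
  have hk1 : k + 1 ≤ 2 * k := by omega
  have hkn : k ≤ k * n := Nat.le_mul_of_pos_right _ hn
  have hnk : n ≤ k * n := Nat.le_mul_of_pos_left _ hk
  have hkk : k * n ≤ k * n * k := Nat.le_mul_of_pos_right _ hk
  set P := s ^ (k + 1)
  set S := s ^ k
  have e1 : (k + 1) * s * s ≤ 2 * (P * (k * n)) := by
    calc (k + 1) * s * s = (k + 1) * (s * s) := by ring
      _ ≤ 2 * (k * n) * P := Nat.mul_le_mul (by omega) hP
      _ = _ := by ring
  have e2 : (k + 1) * s * (5 * s + 8) ≤ 18 * (P * (k * n)) := by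
    calc (k + 1) * s * (5 * s + 8) ≤ (k + 1) * s * (9 * s) := Nat.mul_le_mul_left _ (by omega)
      _ = 9 * ((k + 1) * s * s) := by ring
      _ ≤ 9 * (2 * (P * (k * n))) := Nat.mul_le_mul_left _ e1
      _ = _ := by ring
  have e3 : 2 * S * (4 * n + 11 + 2 ^ q) ≤ 42 * (P * (k * n)) := by
    calc 2 * S * (4 * n + 11 + 2 ^ q) ≤ 2 * P * (21 * (k * n)) :=
          Nat.mul_le_mul (by omega) (by omega)
      _ = _ := by ring
  have e4 : 3 * (k * ((k + 1) * 2 ^ q * S * (2 * s + 1))) ≤ 108 * (P * (k * n) * k) := by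
    calc 3 * (k * ((k + 1) * 2 ^ q * S * (2 * s + 1)))
        ≤ 3 * (k * (2 * k * (6 * n) * S * (3 * s))) := by
          gcongr
          omega
      _ = 108 * (S * s * (k * n) * k) := by ring
      _ = _ := by rw [hPS]
  have e5 : 2 * ((k + 1) * 2 ^ q * S) ≤ 24 * (P * (k * n)) := by
    calc 2 * ((k + 1) * 2 ^ q * S) ≤ 2 * (2 * k * (6 * n) * P) := by gcongr
      _ = _ := by ring
  have e6 : 2 ^ q * S ≤ 6 * (P * (k * n)) := by
    calc 2 ^ q * S ≤ 6 * (k * n) * P := Nat.mul_le_mul (by omega) hS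
      _ = _ := by ring
  have e7 : q * (S * 2 ^ q * 3) ≤ 18 * (P * (k * n) * q) := by
    calc q * (S * 2 ^ q * 3) ≤ q * (P * (6 * (k * n)) * 3) := by
          gcongr
          omega
      _ = _ := by ring
  have e8 : S * (4 * n + 3) ≤ 7 * (P * (k * n)) := by
    calc S * (4 * n + 3) ≤ P * (7 * (k * n)) := Nat.mul_le_mul hS (by omega)
      _ = _ := by ring
  have e9 : P * (k * n) ≤ P * (k * n) * k := Nat.le_mul_of_pos_right _ hk
  -- `e1`, `e2`, `e3`, `e5`, `e6` and `e8` add up to 99, to which `e4` adds 108.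
  calc _ ≤ 207 * (P * (k * n) * k) + 18 * (P * (k * n) * q) := by omega
    _ = _ := by ring

theorem joinCost_le_log {s k n q : ℕ} (hs : 2 ≤ s) (hk : 1 ≤ k) (hn : 1 ≤ n)
    (hq : 2 ^ q ≤ 6 * n) :
    (joinCost s k n q : ℝ) ≤
      522 * ((s : ℝ) ^ (k + 1) * k * n * (k * Real.log s + Real.log n)) := by
  have hlog2 : 1 / 2 < Real.log 2 := by linarith [Real.log_two_gt_d9]
  have hlogs : Real.log 2 ≤ Real.log s :=
    Real.log_le_log (by norm_num) (by exact_mod_cast hs)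
  have hlogn : 0 ≤ Real.log n := Real.log_nonneg (by exact_mod_cast hn)
  have hk' : (1 : ℝ) ≤ k := by exact_mod_cast hk
  have h1 : k * Real.log 2 ≤ k * Real.log s := by gcongr
  have h2 : (q : ℝ) * Real.log 2 ≤ 3 * Real.log 2 + Real.log n := by
    have h3 : Real.log (2 ^ q) ≤ Real.log (2 ^ 3 * n) := by
      refine Real.log_le_log (by positivity) ?_
      have : 2 ^ q ≤ 2 ^ 3 * n := by omega
      exact_mod_cast this
    rw [Real.log_mul (by norm_num) (by exact_mod_cast (by omega : n ≠ 0)), Real.log_pow,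
      Real.log_pow] at h3
    exact_mod_cast h3
  -- As `log 2 > 1/2`, the first term is at most `414 k log s` and the second at most `108 log 2 +
  -- 36 log n`; and `414 + 108 = 522`.
  have h4 : (207 * k + 18 * q : ℝ) ≤ 522 * (k * Real.log s + Real.log n) := by
    nlinarith
  calc (joinCost s k n q : ℝ) ≤ (s : ℝ) ^ (k + 1) * k * n * (207 * k + 18 * q) := by
        exact_mod_cast joinCost_le hs hk hn hq
    _ ≤ (s : ℝ) ^ (k + 1) * k * n * (522 * (k * Real.log s + Real.log n)) := by gcongr
    _ = _ := by ring

theorem numExact_le (τ : Set ℕ) : numExact τ ≤ lastLabel τ + 1 := by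
  have := numExact_eq τ
  omega

theorem rootOrder_le {σ ρ : Set ℕ} {k n q : ℕ} (hk : 1 ≤ k) (hn : 1 ≤ n) (hq : 2 ^ q ≤ 6 * n) :
    rootOrder σ ρ k (2 ^ q) ≤ (numLabels σ ρ ^ k * n) ^ 7 := by
  have hcard : numLabels σ ρ = lastLabel σ + 1 + (lastLabel ρ + 1) := by simp [numLabels]
  have hs : 2 ≤ numLabels σ ρ := by omega
  have hsk : numLabels σ ρ ≤ numLabels σ ρ ^ k := Nat.le_self_pow (by omega) _
  have hX : numLabels σ ρ ^ k ≤ numLabels σ ρ ^ k * n := Nat.le_mul_of_pos_right _ hn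
  have hnX : n ≤ numLabels σ ρ ^ k * n := Nat.le_mul_of_pos_left _ (by positivity)
  have hkX : k + 1 ≤ numLabels σ ρ ^ k * n := (Nat.lt_pow_self hs).trans_le hX
  have h₁ := numExact_le σ
  have h₂ := numExact_le ρ
  set X := numLabels σ ρ ^ k * n
  have hX2 : 2 ≤ X := by omega
  calc rootOrder σ ρ k (2 ^ q) ≤ X * X * X * (2 ^ 3 * X) := by
        unfold rootOrder
        gcongr
        all_goals omega
    _ ≤ X * X * X * (X ^ 3 * X) := by gcongr
    _ = X ^ 7 := by ring

theorem fieldBound_le {s k n : ℕ} (hs : 2 ≤ s) (hk : 1 ≤ k) (hn : 1 ≤ n) :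
    s ^ (2 * k) + 2 * n + 1 ≤ (s ^ k * n) ^ 4 := by
  have hsk : s ≤ s ^ k := Nat.le_self_pow (by omega) _
  have hX : s ^ k ≤ s ^ k * n := Nat.le_mul_of_pos_right _ hn
  have hnX : n ≤ s ^ k * n := Nat.le_mul_of_pos_left _ (by positivity)
  have h1 : s ^ (2 * k) ≤ (s ^ k * n) ^ 2 := by
    rw [mul_comm, pow_mul]
    gcongr
  set X := s ^ k * n
  have hX2 : 2 ≤ X := by omega
  have h2 : 2 * X ≤ X * X := Nat.mul_le_mul_right _ hX2
  have h3 : 4 * (X * X) ≤ X * X * (X * X) := by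
    rw [mul_comm (X * X) (X * X)]
    exact Nat.mul_le_mul_right _ (Nat.mul_le_mul hX2 hX2)
  have h4 : X ^ 2 = X * X := by ring
  have h5 : X ^ 4 = X * X * (X * X) := by ring
  omega

end Cost

/-- A choice of a prime field, of a root of unity and of two tables. -/
structure JoinInput (σ ρ : Set ℕ) (k n R M : ℕ) where
  p : ℕ
  prime : Fact p.Prime
  lt : M < p
  ω : ZMod p
  isPrimitiveRoot : IsPrimitiveRoot ω R
  Al : Table σ ρ k
  Ar : Table σ ρ k
  le_left : ∀ c, ∀ m ∈ Al c, m ≤ n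
  le_right : ∀ c, ∀ m ∈ Ar c, m ≤ n

instance {σ ρ : Set ℕ} {k n R M : ℕ} (x : JoinInput σ ρ k n R M) : Fact x.p.Prime := x.prime

theorem encode_eq_embed (p : ℕ) [Fact p.Prime] (a : Option ℕ) : encode p a = embed (ZMod p) a := by
  cases a <;> rfl

/-- A single program joins all pairs of tables over all admissible prime fields. -/
theorem exists_program (o : Objective) (σ ρ : Set ℕ) (k n q M : ℕ) (hq : 2 * n < 2 ^ q)
    (hn : n + 1 ≤ M) (hM : numLabels σ ρ ^ (2 * k) ≤ M) :
    ∃ P : Program (Colouring σ ρ k ⊕ Colouring σ ρ k) (Colouring σ ρ k),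
      P.cost ≤ joinCost (numLabels σ ρ) k n q ∧
      ∀ (p : ℕ) [Fact p.Prime] (ω : ZMod p), M < p →
        IsPrimitiveRoot ω (rootOrder σ ρ k (2 ^ q)) → ∀ Al Ar : Table σ ρ k,
        (∀ c, ∀ m ∈ Al c, m ≤ n) → (∀ c, ∀ m ∈ Ar c, m ≤ n) →
        ∀ c, P.eval ω (encodeTables p Al Ar) c = encode p (joinTable o Al Ar c) := by
  have hcast : ∀ (x : JoinInput σ ρ k n (rootOrder σ ρ k (2 ^ q)) M) (m : ℕ), 0 < m → m ≤ M →
      (m : ZMod x.p) ≠ 0 := by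
    intro x m h1 h2 h3
    have := Nat.le_of_dvd h1 ((ZMod.natCast_eq_zero_iff _ _).1 h3)
    have := x.lt
    omega
  obtain ⟨code, hcode, h⟩ := derives_joinTable
    (E := JoinInput σ ρ k n (rootOrder σ ρ k (2 ^ q)) M) (F := fun x => ZMod x.p)
    (ω := fun x => x.ω) (inp := fun x => encodeTables x.p x.Al x.Ar) o n q hq
    (fun x => x.Al) (fun x => x.Ar) (fun x => x.le_left) (fun x => x.le_right)
    (fun x c => encode_eq_embed _ _) (fun x c => encode_eq_embed _ _)
    (fun x => x.isPrimitiveRoot) (fun x m h1 h2 => hcast x m h1 (h2.trans hn))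
    (fun x m h1 h2 => hcast x m h1 (h2.trans hM)) [] (by simp)
  -- The positions do not depend on the environment, so they are the outputs of one program for all
  -- primes, roots and tables.
  choose out _ hout using fun c => h _ ⟨c, rfl⟩
  refine ⟨⟨code, out⟩, hcode, fun p hp ω hlt hω Al Ar hAl hAr c => ?_⟩
  rw [encode_eq_embed]
  exact hout c ⟨p, hp, hlt, ω, hω, Al, Ar, hAl, hAr⟩

end SigmaRho

theorem mainTheorem1 :
    ∃ K : ℕ, ∀ (o : SigmaRho.Objective) (σ ρ : Set ℕ),
      σ.Nonempty → ρ.Nonempty → (σ.Finite ∨ σᶜ.Finite) → (ρ.Finite ∨ ρᶜ.Finite) →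
      ∀ k n : ℕ, 1 ≤ k → 1 ≤ n →
      ∃ (R M : ℕ) (P : SigmaRho.Program
          (SigmaRho.Colouring σ ρ k ⊕ SigmaRho.Colouring σ ρ k) (SigmaRho.Colouring σ ρ k)),
        1 ≤ R ∧ 2 * n + 1 ≤ M ∧
        R ≤ (SigmaRho.numLabels σ ρ ^ k * n) ^ K ∧ M ≤ (SigmaRho.numLabels σ ρ ^ k * n) ^ K ∧
        (P.cost : ℝ) ≤ K * ((SigmaRho.numLabels σ ρ : ℝ) ^ (k + 1) * k * n *
          (k * Real.log (SigmaRho.numLabels σ ρ) + Real.log n)) ∧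
        ∀ (p : ℕ) [Fact p.Prime] (ω : ZMod p), M < p → IsPrimitiveRoot ω R →
          (∀ Al Ar : SigmaRho.Table σ ρ k,
            (∀ c, ∀ m ∈ Al c, m ≤ n) → (∀ c, ∀ m ∈ Ar c, m ≤ n) →
            ∀ c, P.eval ω (SigmaRho.encodeTables p Al Ar) c =
              SigmaRho.encode p (SigmaRho.joinTable o Al Ar c)) ∧
          (∀ (V : Type*) [Fintype V] (G : SimpleGraph V) (T : Type*)
            (t : SigmaRho.RootedTreeDecomposition G T) (i l r : T) (x : Fin k → V),
            Fintype.card V = n → t.IsJoinNode i l r →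
            Function.Injective x → Set.range x = t.bag i →
            ∀ c, P.eval ω (SigmaRho.encodeTables p
                (t.memoTable σ ρ o l x) (t.memoTable σ ρ o r x)) c =
              SigmaRho.encode p (t.memoTable σ ρ o i x c)) := by
  refine ⟨522, fun o σ ρ _ _ _ _ k n hk hn => ?_⟩
  have hs : 2 ≤ SigmaRho.numLabels σ ρ := by
    simp only [SigmaRho.numLabels, Fintype.card_sum, Fintype.card_fin]
    omega
  have hX : 0 < SigmaRho.numLabels σ ρ ^ k * n := by positivity
  -- The least `q` with `2 ^ q > 2 * n`, so that all total values fit and `2 ^ q` is still O(n).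
  set q := Nat.log 2 (2 * n) + 1 with hq
  have hq1 : 2 * n < 2 ^ q := Nat.lt_pow_succ_log_self (by norm_num) _
  have hq2 : 2 ^ q ≤ 6 * n := by
    have := Nat.pow_log_le_self 2 (show 2 * n ≠ 0 by omega)
    rw [hq, pow_succ]
    omega
  obtain ⟨P, hcost, hP⟩ := SigmaRho.exists_program o σ ρ k n q
    (SigmaRho.numLabels σ ρ ^ (2 * k) + 2 * n + 1) hq1 (by omega) (by omega)
  refine ⟨SigmaRho.rootOrder σ ρ k (2 ^ q), _, P, ?_, by omega,
    (SigmaRho.rootOrder_le hk hn hq2).trans (Nat.pow_le_pow_right hX (by norm_num)),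
    (SigmaRho.fieldBound_le hs hk hn).trans (Nat.pow_le_pow_right hX (by norm_num)), ?_, ?_⟩
  · unfold SigmaRho.rootOrder
    exact Nat.succ_le_of_lt (by positivity)
  · exact (Nat.cast_le.2 hcost).trans (SigmaRho.joinCost_le_log hs hk hn hq2)
  · intro p hp ω hlt hω
    refine ⟨hP p ω hlt hω, ?_⟩
    intro V _ G T t i l r x hV hjoin _ hx c
    -- Entries of memoisation tables are at most `|V| = n`, so the second claim becomes an instance
    -- of the first.
    rw [hjoin.memoTable_eq σ ρ o hx]
    subst hV
    exact hP p ω hlt hω _ _ (t.memoTable_le_card σ ρ o l x) (t.memoTable_le_card σ ρ o r x) c
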